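/- **Conventions.** Hilbert spaces are complex and $\langle\cdot|\cdot\rangle$ is linear in the second variable. A *self-dual cone* in a Hilbert space $\mathfrak H$ is a closed convex set $\mathfrak P\subset\mathfrak H$ with $t\mathfrak P\subseteq\mathfrak P$ for $t\ge 0$, $\mathfrak P\cap(-\mathfrak P)=\{0\}$ and $\mathfrak P=\{\eta\mid\langle\eta|\xi\rangle\ge 0\ \forall\xi\in\mathfrak P\}$. For bounded $T$ write $T\unrhd 0$ w.r.t. $\mathfrak P$ if $T\mathfrak P\subseteq\mathfrak P$, and $T\rhd 0$ w.r.t. $\mathfrak P$ if for every $\xi\in\mathfrak P\setminus\{0\}$ one has $T\xi\in\mathfrak P$ and $\langle\eta|T\xi\rangle>0$ for all $\eta\in\mathfrak P\setminus\{0\}$. Let $\mathscr A^+_{\mathfrak P}$ be the set of self-adjoint operators $H$ in $\mathfrak H$ that are bounded from below, have purely discrete spectrum (only isolated eigenvalues of finite multiplicity), and satisfy $(H+s)^{-1}\rhd 0$ w.r.t. $\mathfrak P$ for all $s>-E(H)$, where $E(H)=\inf\mathrm{spec}(H)$. **Stability classes.** If $\mathfrak H_1$ is a closed subspace of $\mathfrak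 H_2$ with orthogonal projection $\pi$, and $\mathfrak P_i\subset\mathfrak H_i$ are self-dual cones, write $(H_1,\mathfrak P_1)\to(H_2,\mathfrak P_2)$ if $H_i\in\mathscr A^+_{\mathfrak P_i}$ $(i=1,2)$, $\mathfrak P_1=\pi\mathfrak P_2$, and $\pi\unrhd 0$ w.r.t. $\mathfrak P_2$. Fix a Hilbert space $\mathfrak H_*$ and a bounded self-adjoint operator $O$ on it with purely discrete spectrum; on a Hilbert space $\mathfrak H\supseteq\mathfrak H_*$ (containing $\mathfrak H_*$ as a closed subspace) $O$ also denotes $O\oplus 0$ with respect to $\mathfrak H=\mathfrak H_*\oplus\mathfrak H_*^\perp$. Let $\mathscr P_{\mathfrak H_*}(O)$ be the set of operators $H$ acting in some $\mathfrak H\supseteq\mathfrak H_*$ with $H\in\mathscr A^+_{\mathfrak P}$ for some self-dual cone $\mathfrak P\subset\mathfrak H$ and $e^{isO}e^{itH}=e^{itH}e^{isO}$ for all $s,t\in\mathbb R$. For $H,K\in\mathscr P_{\mathfrak H_*}(O)$ write $H\to K$ if there are $H=H_1,H_2,\dots,H_N=K$ in $\mathscr P_{\mathfrak H_*}(O)$,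 $N\ge 2$, acting in spaces each of which is a closed subspace of the next, and self-dual cones $\mathfrak P_j,\mathfrak P_j'$ with $(H_j,\mathfrak P_j)\to(H_{j+1},\mathfrak P_{j+1}')$ for $1\le j<N$. The stability class of $H_*$ is $\mathscr U_O(H_*)=\{H\in\mathscr P_{\mathfrak H_*}(O)\mid H_*\to H\}$. If $E(H)$ is a simple eigenvalue of $H$ with eigenvector $\psi_H$ and $O\psi_H=m\psi_H$, we write $\mu(H)=m$. **Spin system.** Let $\Lambda$ be a finite set with $|\Lambda|$ even, $\Lambda=A\cup B$, $A\cap B=\varnothing$. On $\bigotimes_{x\in\Lambda}\mathbb C^2$ let $\boldsymbol S_x=(S_x^{(1)},S_x^{(2)},S_x^{(3)})$ be the spin-$\frac12$ operators at $x$ (one half of the Pauli matrices acting on the factor $x$), and put $\boldsymbol S_A=\sum_{x\in A}\boldsymbol S_x$, $\boldsymbol S_B=\sum_{x\in B}\boldsymbol S_x$, $\boldsymbol S_{\mathrm{tot}}=\sum_{x\in\Lambda}\boldsymbol S_x$, $H_{\mathrm{MLM}}=\boldsymbol S_A\cdot\boldsymbol S_B=\sum_{j=1}^3S_A^{(j)}S_B^{(j)}$,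 and $\mathfrak H_0=\ker S_{\mathrm{tot}}^{(3)}$, a subspace invariant under $H_{\mathrm{MLM}}$ and $\boldsymbol S_{\mathrm{tot}}^2$. Take $\mathfrak H_*=\mathfrak H_0$, and let $O$ be $\boldsymbol S_{\mathrm{tot}}^2$ on $\mathfrak H_0$. **Theorem.** For every Hamiltonian $H\in\mathscr U_O(H_{\mathrm{MLM}}\restriction\mathfrak H_0)$, $E(H)$ is a simple eigenvalue of $H$ and $$\mu(H)=S_*(S_*+1),\qquad S_*=\tfrac12\big||A|-|B|\big|,$$ that is, the ground state $\psi_H$ satisfies $O\psi_H=S_*(S_*+1)\psi_H$. -/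

import Mathlib

open scoped ComplexOrder InnerProductSpace

universe u

namespace SpinStability

noncomputable section

/-! ## Self-dual cones and positivity -/

section Cones

variable {E : Type*} [NormedAddCommGroup E] [InnerProductSpace ℂ E]

/-- A self-dual cone in a complex Hilbert space: a closed convex set `P`, stable under
multiplication by reals `t ≥ 0`, with `P ∩ (-P) = {0}`, which equals its dual cone
`{η | ⟪η, ξ⟫ ≥ 0 for all ξ ∈ P}`.  The order on `ℂ` is the usual partial one: `0 ≤ z` means that
`z` is real and nonnegative. -/
structure IsSelfDualCone (P : Set E) : Prop where
  isClosed : IsClosed P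
  convex : Convex ℝ P
  smul_mem : ∀ t : ℝ, 0 ≤ t → ∀ ξ ∈ P, (t : ℂ) • ξ ∈ P
  pointed : P ∩ (-P) = {0}
  selfDual : P = {η : E | ∀ ξ ∈ P, 0 ≤ ⟪η, ξ⟫_ℂ}

/-- `η > 0` with respect to `P`. -/
def StrictlyPositive (P : Set E) (η : E) : Prop :=
  η ∈ P ∧ ∀ ξ ∈ P, ξ ≠ 0 → 0 < ⟪ξ, η⟫_ℂ

/-- `T ⊵ 0` with respect to `P`. -/
def PositivityPreserving (P : Set E) (T : E →L[ℂ] E) : Prop :=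
  ∀ ξ ∈ P, T ξ ∈ P

/-- `T ▷ 0` with respect to `P`. -/
def PositivityImproving (P : Set E) (T : E →L[ℂ] E) : Prop :=
  ∀ ξ ∈ P, ξ ≠ 0 → StrictlyPositive P (T ξ)

end Cones

/-! ## Unbounded operators: resolvent, spectrum, ground state energy, unitary group -/

section Unbounded

variable {E : Type*} [NormedAddCommGroup E] [InnerProductSpace ℂ E]

/-- `R` is the bounded everywhere defined inverse of `H - z`. -/
def IsResolventAt (H : E →ₗ.[ℂ] E) (z : ℂ) (R : E →L[ℂ] E) : Prop :=
  (∀ y : E, ∃ h : R y ∈ H.domain, H ⟨R y, h⟩ - z • R y = y) ∧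
    ∀ x : H.domain, R (H x - z • (x : E)) = x

/-- The spectrum of an unbounded operator. -/
def spec (H : E →ₗ.[ℂ] E) : Set ℂ :=
  {z | ¬ ∃ R : E →L[ℂ] E, IsResolventAt H z R}

/-- `E(H) = inf spec(H)`.  (For a self-adjoint operator that is bounded from below on a nonzero
space, the spectrum is a nonempty set of reals which is bounded from below.) -/
def groundEnergy (H : E →ₗ.[ℂ] E) : ℝ :=
  sInf {r : ℝ | (r : ℂ) ∈ spec H}

/-- The eigenspace `ker (H - z)`, a subspace of the domain of `H`. -/
def eigenspace (H : E →ₗ.[ℂ] E) (z : ℂ) : Submodule ℂ E :=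
  (LinearMap.ker (H.toFun - z • H.domain.subtype)).map H.domain.subtype

def IsBoundedBelow (H : E →ₗ.[ℂ] E) : Prop :=
  ∃ c : ℝ, ∀ x : H.domain, c * ‖(x : E)‖ ^ 2 ≤ (⟪(x : E), H x⟫_ℂ).re

/-- Purely discrete spectrum: every point of the spectrum is an isolated point of it and an
eigenvalue of finite multiplicity. -/
def HasPurelyDiscreteSpectrum (H : E →ₗ.[ℂ] E) : Prop :=
  ∀ z ∈ spec H, (∃ ε > 0, ∀ w ∈ spec H, dist w z < ε → w = z) ∧
    eigenspace H z ≠ ⊥ ∧ FiniteDimensional ℂ (eigenspace H z)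

variable [CompleteSpace E]

/-- `H ∈ 𝒜⁺_P`: `H` is self-adjoint, bounded from below, has purely discrete spectrum, and
`(H + s)⁻¹ ▷ 0` with respect to `P` for all `s > -E(H)`. -/
structure HasPositivityImprovingResolvent (P : Set E) (H : E →ₗ.[ℂ] E) : Prop where
  isSelfAdjoint : IsSelfAdjoint H
  isBoundedBelow : IsBoundedBelow H
  discrete : HasPurelyDiscreteSpectrum H
  improving : ∀ s : ℝ, -groundEnergy H < s →
    ∃ R : E →L[ℂ] E, IsResolventAt H (-(s : ℂ)) R ∧ PositivityImproving P R

/-- `U t = e^{itH}`: `U` is the strongly continuous one-parameter unitary group whose generator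
is `iH`, domain included.  (By Stone's theorem there is exactly one such `U` if `H` is
self-adjoint.) -/
structure IsUnitaryGroupOf (H : E →ₗ.[ℂ] E) (U : ℝ → E →L[ℂ] E) : Prop where
  unitary : ∀ t, U t ∈ unitary (E →L[ℂ] E)
  zero : U 0 = 1
  add : ∀ s t, U (s + t) = U s * U t
  continuous : ∀ x, Continuous fun t => U t x
  generator : ∀ x y : E, HasDerivAt (fun t : ℝ => U t x) y 0 ↔
    ∃ h : x ∈ H.domain, y = Complex.I • H ⟨x, h⟩

/-- `e^{isO} e^{itH} = e^{itH} e^{isO}` for all real `s`, `t`. -/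
def StronglyCommutes (O : E →L[ℂ] E) (H : E →ₗ.[ℂ] E) : Prop :=
  ∃ U : ℝ → E →L[ℂ] E, IsUnitaryGroupOf H U ∧ ∀ s t : ℝ,
    NormedSpace.exp ((Complex.I * (s : ℂ)) • O) * U t =
      U t * NormedSpace.exp ((Complex.I * (s : ℂ)) • O)

end Unbounded

/-! ## Hamiltonians over a fixed Hilbert space and their stability classes -/

section Stability

/-- An operator in a Hilbert space that contains the given Hilbert space `X` as a closed subspace;
the inclusion is given as a linear isometry. -/
structure Hamiltonian (X : Type u) [NormedAddCommGroup X] [InnerProductSpace ℂ X] :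
    Type (u + 1) where
  space : Type u
  [normed : NormedAddCommGroup space]
  [inner : InnerProductSpace ℂ space]
  [complete : CompleteSpace space]
  incl : X →ₗᵢ[ℂ] space
  op : space →ₗ.[ℂ] space

attribute [instance] Hamiltonian.normed Hamiltonian.inner Hamiltonian.complete

variable {X : Type u} [NormedAddCommGroup X] [InnerProductSpace ℂ X] [CompleteSpace X]

/-- A bounded operator on `X`, regarded as a Hamiltonian acting in `X` itself. -/
def Hamiltonian.ofCLM (T : X →L[ℂ] X) : Hamiltonian X where
  space := X
  incl := LinearIsometry.id
  op := LinearMap.toPMap (T : X →ₗ[ℂ] X) ⊤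

/-- The natural extension `O ⊕ 0` of a bounded operator `O` on `X` to a Hilbert space
`F = X ⊕ X^⊥`. -/
def naturalExtension {F : Type*} [NormedAddCommGroup F] [InnerProductSpace ℂ F] [CompleteSpace F]
    (ι : X →ₗᵢ[ℂ] F) (O : X →L[ℂ] X) : F →L[ℂ] F :=
  ι.toContinuousLinearMap ∘L O ∘L (ContinuousLinearMap.adjoint ι.toContinuousLinearMap)

/-- The set of Hamiltonians that lie in `𝒜⁺_P` for some self-dual cone `P` of the Hilbert space
in which they act, and that strongly commute with (the natural extension of) `O`. -/
def admissible (O : X →L[ℂ] X) : Set (Hamiltonian X) :=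
  {K | (∃ P : Set K.space, IsSelfDualCone P ∧ HasPositivityImprovingResolvent P K.op) ∧
    StronglyCommutes (naturalExtension K.incl O) K.op}

/-- For `τ : E₁ → E₂` the inclusion of a closed subspace, with orthogonal projection `π = τ*`:
the positivity is inherited from `P₁` to `P₂`, that is, `P₁ = π P₂` and `π ⊵ 0` with respect to
`P₂`. -/
def PositivityInherited {E₁ E₂ : Type*}
    [NormedAddCommGroup E₁] [InnerProductSpace ℂ E₁] [CompleteSpace E₁]
    [NormedAddCommGroup E₂] [InnerProductSpace ℂ E₂] [CompleteSpace E₂]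
    (τ : E₁ →ₗᵢ[ℂ] E₂) (P₁ : Set E₁) (P₂ : Set E₂) : Prop :=
  P₁ = ContinuousLinearMap.adjoint τ.toContinuousLinearMap '' P₂ ∧
    PositivityPreserving P₂
      (τ.toContinuousLinearMap ∘L ContinuousLinearMap.adjoint τ.toContinuousLinearMap)

/-- `(H₁, P₁) → (H₂, P₂)` for some self-dual cones `P₁`, `P₂`: the space of `H₁` is a closed
subspace of the space of `H₂` (compatibly with the inclusions of `X`), `H₁ ∈ 𝒜⁺_{P₁}`,
`H₂ ∈ 𝒜⁺_{P₂}`, and the positivity is inherited from `P₁` to `P₂`. -/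
def Step (K₁ K₂ : Hamiltonian X) : Prop :=
  ∃ (τ : K₁.space →ₗᵢ[ℂ] K₂.space) (P₁ : Set K₁.space) (P₂ : Set K₂.space),
    (∀ x, τ (K₁.incl x) = K₂.incl x) ∧
    IsSelfDualCone P₁ ∧ IsSelfDualCone P₂ ∧
    HasPositivityImprovingResolvent P₁ K₁.op ∧ HasPositivityImprovingResolvent P₂ K₂.op ∧
    PositivityInherited τ P₁ P₂

/-- The preorder `H → H'` on the Hamiltonians that are admissible for `O`: the two are connected
by a finite chain of steps `(H₁, P₁) → (H₂, P₂')`, `(H₂, P₂) → (H₃, P₃')`, … of such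
Hamiltonians; the cone may be changed between consecutive steps. -/
def Connected (O : X →L[ℂ] X) : Hamiltonian X → Hamiltonian X → Prop :=
  Relation.TransGen fun K₁ K₂ => K₁ ∈ admissible O ∧ K₂ ∈ admissible O ∧ Step K₁ K₂

/-- The stability class `𝒰_O(H⋆)`. -/
def stabilityClass (O : X →L[ℂ] X) (K : Hamiltonian X) : Set (Hamiltonian X) :=
  {K' | K' ∈ admissible O ∧ Connected O K K'}

/-- `μ(H) = m`: the ground state energy `E(H)` is a simple eigenvalue of `H`, and the ground state
`ψ_H` satisfies `O ψ_H = m ψ_H`. -/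
def HasGroundStateQuantumNumber (O : X →L[ℂ] X) (K : Hamiltonian X) (m : ℝ) : Prop :=
  Module.finrank ℂ (eigenspace K.op (groundEnergy K.op : ℂ)) = 1 ∧
    ∀ ψ ∈ eigenspace K.op (groundEnergy K.op : ℂ),
      naturalExtension K.incl O ψ = (m : ℂ) • ψ

end Stability

/-! ## Spin-1/2 systems -/

section Spin

/-- The Hilbert space `⊗_{x ∈ Λ} ℂ²` of spins 1/2, with its orthonormal basis indexed by the spin
configurations `Λ → Fin 2` (`0` is spin up, `1` is spin down). -/
abbrev SpinSpace (Λ : Type u) [Fintype Λ] : Type u := EuclideanSpace ℂ (Λ → Fin 2)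

/-- The three Pauli matrices. -/
def pauli : Fin 3 → Matrix (Fin 2) (Fin 2) ℂ :=
  ![!![0, 1; 1, 0], !![0, -Complex.I; Complex.I, 0], !![1, 0; 0, -1]]

variable {Λ : Type u} [Fintype Λ] [DecidableEq Λ]

/-- The operator that acts as the matrix `M` on the tensor factor at the site `x` and as the
identity on all others. -/
def siteOp (x : Λ) (M : Matrix (Fin 2) (Fin 2) ℂ) : SpinSpace Λ →L[ℂ] SpinSpace Λ :=
  LinearMap.toContinuousLinearMap
    { toFun := fun φ => WithLp.toLp 2 fun σ => ∑ s, M (σ x) s * φ (Function.update σ x s)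
      map_add' := fun φ ψ => by
        ext σ
        simp [mul_add, Finset.sum_add_distrib]
      map_smul' := fun c φ => by
        ext σ
        simp only [PiLp.smul_apply, smul_eq_mul, RingHom.id_apply, Finset.mul_sum]
        exact Finset.sum_congr rfl fun s _ => by ring }

/-- The spin operator `S_x^{(j)}`, `j = 0, 1, 2` standing for the three components. -/
def spin (x : Λ) (j : Fin 3) : SpinSpace Λ →L[ℂ] SpinSpace Λ :=
  siteOp x ((1 / 2 : ℂ) • pauli j)

/-- `S_A^{(j)} = ∑_{x ∈ A} S_x^{(j)}`. -/
def spinOn (A : Finset Λ) (j : Fin 3) : SpinSpace Λ →L[ℂ] SpinSpace Λ :=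
  ∑ x ∈ A, spin x j

/-- `S_A · S_B = ∑_j S_A^{(j)} S_B^{(j)}`. -/
def spinDot (A B : Finset Λ) : SpinSpace Λ →L[ℂ] SpinSpace Λ :=
  ∑ j, spinOn A j * spinOn B j

variable (Λ) in
/-- The subspace `𝔥_M = ker (S_tot^{(3)} - M)` for `M = 0`. -/
abbrev zeroSector : Submodule ℂ (SpinSpace Λ) :=
  (spinOn (Finset.univ : Finset Λ) 2).ker

@[simp] lemma siteOp_apply (x : Λ) (M : Matrix (Fin 2) (Fin 2) ℂ) (φ : SpinSpace Λ)
    (σ : Λ → Fin 2) :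
    siteOp x M φ σ = ∑ s, M (σ x) s * φ (Function.update σ x s) := rfl

lemma siteOp_mul (x : Λ) (M N : Matrix (Fin 2) (Fin 2) ℂ) :
    siteOp x M * siteOp x N = siteOp x (M * N) := by
  ext φ σ
  simp [Matrix.mul_apply]
  ring

lemma siteOp_comm {x y : Λ} (h : x ≠ y) (M N : Matrix (Fin 2) (Fin 2) ℂ) :
    siteOp x M * siteOp y N = siteOp y N * siteOp x M := by
  ext φ σ
  simp [h, h.symm, Function.update_comm h]
  ring

lemma siteOp_sub (x : Λ) (M N : Matrix (Fin 2) (Fin 2) ℂ) :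
    siteOp x (M - N) = siteOp x M - siteOp x N := by
  ext φ σ
  simp
  ring

lemma siteOp_smul (x : Λ) (c : ℂ) (M : Matrix (Fin 2) (Fin 2) ℂ) :
    siteOp x (c • M) = c • siteOp x M := by
  ext φ σ
  simp
  ring

/-- `[S_x^{(3)}, S_x^{(j)}]` as in the standard commutation relations, with `c` and `k` such that
`[S_x^{(3)}, S_x^{(j)}] = c S_x^{(k)}`. -/
lemma spinOn_comm (A : Finset Λ) (j k : Fin 3) (c : ℂ)
    (h : ((1 / 2 : ℂ) • pauli 2) * ((1 / 2 : ℂ) • pauli j)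
      - ((1 / 2 : ℂ) • pauli j) * ((1 / 2 : ℂ) • pauli 2) = c • ((1 / 2 : ℂ) • pauli k)) :
    spinOn Finset.univ 2 * spinOn A j - spinOn A j * spinOn Finset.univ 2 = c • spinOn A k := by
  have key : ∀ y x : Λ, spin y 2 * spin x j - spin x j * spin y 2 =
      if y = x then c • spin x k else 0 := by
    intro y x
    split_ifs with hyx
    · subst hyx
      simp only [spin]
      rw [siteOp_mul, siteOp_mul, ← siteOp_sub, h, siteOp_smul]
    · simp only [spin]
      rw [siteOp_comm hyx, sub_self]
  simp only [spinOn]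
  rw [Finset.sum_mul_sum, Finset.sum_mul_sum, Finset.sum_comm, ← Finset.sum_sub_distrib,
    Finset.smul_sum]
  refine Finset.sum_congr rfl fun x _ => ?_
  rw [← Finset.sum_sub_distrib]
  simp [key]

lemma commute_of_commutators {R : Type*} [Ring R] [Algebra ℂ R] (T a₀ a₁ a₂ b₀ b₁ b₂ : R) (c : ℂ)
    (ha₀ : T * a₀ - a₀ * T = c • a₁) (ha₁ : T * a₁ - a₁ * T = (-c) • a₀)
    (ha₂ : T * a₂ - a₂ * T = (0 : ℂ) • a₂)
    (hb₀ : T * b₀ - b₀ * T = c • b₁) (hb₁ : T * b₁ - b₁ * T = (-c) • b₀)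
    (hb₂ : T * b₂ - b₂ * T = (0 : ℂ) • b₂) :
    T * (a₀ * b₀ + a₁ * b₁ + a₂ * b₂) = (a₀ * b₀ + a₁ * b₁ + a₂ * b₂) * T := by
  have leibniz : ∀ a b : R, T * (a * b) - a * b * T =
      (T * a - a * T) * b + a * (T * b - b * T) := fun a b => by noncomm_ring
  have h : T * (a₀ * b₀ + a₁ * b₁ + a₂ * b₂) - (a₀ * b₀ + a₁ * b₁ + a₂ * b₂) * T =
      (T * (a₀ * b₀) - a₀ * b₀ * T) + (T * (a₁ * b₁) - a₁ * b₁ * T)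
        + (T * (a₂ * b₂) - a₂ * b₂ * T) := by noncomm_ring
  rw [← sub_eq_zero, h, leibniz, leibniz, leibniz, ha₀, ha₁, ha₂, hb₀, hb₁, hb₂]
  simp only [zero_smul, neg_smul, smul_mul_assoc, mul_smul_comm, zero_mul, mul_zero, neg_mul,
    mul_neg]
  abel

lemma commute_spinDot (A B : Finset Λ) :
    spinOn (Finset.univ : Finset Λ) 2 * spinDot A B =
      spinDot A B * spinOn (Finset.univ : Finset Λ) 2 := by
  have h0 := fun C : Finset Λ => spinOn_comm C 0 1 Complex.I (by
    ext i j; fin_cases i <;> fin_cases j <;> simp [pauli] <;> ring_nf <;> simp <;> ring)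
  have h1 := fun C : Finset Λ => spinOn_comm C 1 0 (-Complex.I) (by
    ext i j; fin_cases i <;> fin_cases j <;> simp [pauli] <;> ring)
  have h2 := fun C : Finset Λ => spinOn_comm C 2 2 0 (by simp)
  simp only [spinDot, Fin.sum_univ_three]
  exact commute_of_commutators _ _ _ _ _ _ _ Complex.I (h0 A) (h1 A) (h2 A) (h0 B) (h1 B) (h2 B)

lemma spinDot_mem_zeroSector (A B : Finset Λ) :
    ∀ φ ∈ zeroSector Λ, spinDot A B φ ∈ zeroSector Λ := by
  intro φ hφ
  have h := congrArg (fun T : SpinSpace Λ →L[ℂ] SpinSpace Λ => T φ) (commute_spinDot A B)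
  have hφ' : spinOn (Finset.univ : Finset Λ) 2 φ = 0 := hφ
  simp only [mul_apply_eq_comp, hφ', map_zero] at h
  exact h

/-- The restriction of `S_A · S_B` to the subspace `𝔥_0`, which it leaves invariant. -/
def spinDotZero (A B : Finset Λ) : zeroSector Λ →L[ℂ] zeroSector Λ :=
  ((spinDot A B).comp (zeroSector Λ).subtypeL).codRestrict (zeroSector Λ)
    fun φ => spinDot_mem_zeroSector A B φ φ.2

/-- The Marshall–Lieb–Mattis Hamiltonian `S_A · S_B` restricted to `𝔥_0`. -/
def mlmHamiltonian (A B : Finset Λ) : Hamiltonian (zeroSector Λ) :=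
  Hamiltonian.ofCLM (spinDotZero A B)

variable (Λ) in
/-- `S_tot² = ∑_j (S_tot^{(j)})²`, as an operator on `𝔥_0`. -/
def totalSpinSq : zeroSector Λ →L[ℂ] zeroSector Λ :=
  spinDotZero Finset.univ Finset.univ

/-- `S⋆ = ||A| - |B|| / 2`. -/
def sStar (A B : Finset Λ) : ℝ := |(A.card : ℝ) - (B.card : ℝ)| / 2

end Spin

end

end SpinStability

namespace SpinStability


/-! ### Self-dual cones and the associated real subspace -/

/-! The quantum number travels along a chain by an overlap argument. By Perron–Frobenius–Faris
(`exists_groundState`), a positivity improving resolvent makes the ground state unique up to a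
scalar and strictly positive. Strong commutation leaves the one-dimensional ground eigenspace
invariant under `O`, so the ground state is an eigenvector of `O` (`exists_quantumNumber`). In a
step the smaller ground state, viewed in the larger space, lies in the larger cone. Its overlap with
the larger ground state is therefore strictly positive, and two eigenvectors of the symmetric
operator `O ⊕ 0` that are not orthogonal share their eigenvalue
(`Step.hasGroundStateQuantumNumber`). Induction along the chain reduces everything to `H_MLM`.

For `H_MLM` with `|B| ≤ |A|` an explicit vector is used, whose amplitude depends only on the number
of up spins in `A` and follows Marshall's sign rule. It satisfies the eigenvalue equation
(`mlmAmplitude_eigenvalue_equation`), and its invariance under exchanges inside `A` and inside `B`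
gives its total spin (`spinDot_univ_mlmGroundState`). A maximum principle for `|φ| / |w|` shows that
its energy is the lowest (`le_eigenvalue_of_mem_zeroSector`). Simplicity needs no separate argument:
membership in a stability class already makes `H_MLM` admissible. -/

/-- Moreau's decomposition with respect to a closed convex cone in a real Hilbert space. -/
lemma exists_moreau_decomposition {F : Type*} [NormedAddCommGroup F] [InnerProductSpace ℝ F]
    [CompleteSpace F] {C : Set F} (hne : C.Nonempty) (hcl : IsClosed C) (hconv : Convex ℝ C)
    (hsmul : ∀ t : ℝ, 0 ≤ t → ∀ ξ ∈ C, t • ξ ∈ C) (x : F) :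
    ∃ p ∈ C, (∀ ξ ∈ C, ⟪x - p, ξ⟫_ℝ ≤ 0) ∧ ⟪x - p, p⟫_ℝ = 0 := by
  obtain ⟨p, hp, hmin⟩ := exists_norm_eq_iInf_of_complete_convex hne hcl.isComplete hconv x
  rw [norm_eq_iInf_iff_real_inner_le_zero hconv hp] at hmin
  -- The multiples `0` and `2p` of `p` test the variational inequality in opposite directions, which
  -- forces orthogonality.
  have h0 := hmin _ (hsmul 0 le_rfl p hp)
  have h2 := hmin _ (hsmul 2 zero_le_two p hp)
  have hpp : ⟪x - p, p⟫_ℝ = 0 := by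
    simp only [inner_sub_right, inner_smul_right] at h0 h2
    linarith
  refine ⟨p, hp, fun ξ hξ => ?_, hpp⟩
  have := hmin ξ hξ
  rw [inner_sub_right, hpp] at this
  linarith

section Cones

variable {E : Type*} [NormedAddCommGroup E] [InnerProductSpace ℂ E] {P : Set E}

/-- `x` lies in the real subspace generated by `P`. -/
def IsRealFor (P : Set E) (x : E) : Prop :=
  ∀ ξ ∈ P, (⟪x, ξ⟫_ℂ).im = 0

lemma IsRealFor.sub_smul {x y : E} (hx : IsRealFor P x) (hy : IsRealFor P y) (t : ℝ) :
    IsRealFor P (x - (t : ℂ) • y) := by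
  intro ξ hξ
  rw [inner_sub_left, inner_smul_left]
  simp [hx ξ hξ, hy ξ hξ]

namespace IsSelfDualCone

lemma inner_nonneg (hP : IsSelfDualCone P) {ξ η : E} (hξ : ξ ∈ P) (hη : η ∈ P) :
    0 ≤ ⟪ξ, η⟫_ℂ := by
  have h := hξ
  rw [hP.selfDual] at h
  exact h η hη

lemma zero_mem (hP : IsSelfDualCone P) : (0 : E) ∈ P := by
  rw [hP.selfDual]
  intro ξ _
  simp

lemma mem_of_re_nonneg (hP : IsSelfDualCone P) {x : E} (hx : IsRealFor P x)
    (h : ∀ ξ ∈ P, 0 ≤ (⟪x, ξ⟫_ℂ).re) : x ∈ P := by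
  rw [hP.selfDual]
  exact fun ξ hξ => Complex.nonneg_iff.2 ⟨h ξ hξ, (hx ξ hξ).symm⟩

lemma isRealFor (hP : IsSelfDualCone P) {x : E} (hx : x ∈ P) : IsRealFor P x :=
  fun _ hξ => (Complex.nonneg_iff.1 (hP.inner_nonneg hx hξ)).2.symm

variable [CompleteSpace E]

/-- Moreau's residual lies in the dual cone up to sign, and self-duality puts it back into `P`.
Moreau works with the real part of the inner product; imaginary parts vanish on real vectors paired
with `P`. -/
lemma exists_pos_sub_neg (hP : IsSelfDualCone P) {x : E} (hx : IsRealFor P x) :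
    ∃ p ∈ P, ∃ q ∈ P, x = p - q ∧ ⟪p, q⟫_ℂ = 0 := by
  let _ : InnerProductSpace ℝ E := InnerProductSpace.complexToReal
  obtain ⟨p, hp, hle, hpp⟩ := exists_moreau_decomposition (C := P) ⟨0, hP.zero_mem⟩ hP.isClosed
    hP.convex (fun t ht ξ hξ => by simpa using hP.smul_mem t ht ξ hξ) x
  have hre : ∀ a b : E, ⟪a, b⟫_ℝ = (⟪a, b⟫_ℂ).re := fun _ _ => rfl
  have hq : p - x ∈ P := by
    refine hP.mem_of_re_nonneg ?_ fun ξ hξ => ?_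
    · simpa using (hP.isRealFor hp).sub_smul hx 1
    · have := hle ξ hξ
      rw [hre] at this
      rw [← neg_sub, inner_neg_left, Complex.neg_re]
      linarith
  refine ⟨p, hp, p - x, hq, by abel, ?_⟩
  refine Complex.ext ?_ (hP.isRealFor hp _ hq)
  rw [hre] at hpp
  rw [← neg_sub x p, inner_neg_right, Complex.neg_re, ← inner_conj_symm, Complex.conj_re, hpp,
    neg_zero, Complex.zero_re]

/-- Split along the real orthogonal complement `W` of the real span of `P`. Pairings within `P` are
real, so `i P ⊆ W`; hence vectors orthogonal to `W` are real, while those in `W` pair with `P` to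
imaginary numbers. -/
lemma exists_re_add_im (hP : IsSelfDualCone P) (x : E) :
    ∃ a b : E, IsRealFor P a ∧ IsRealFor P b ∧ x = a + Complex.I • b := by
  let _ : InnerProductSpace ℝ E := InnerProductSpace.complexToReal
  have hre : ∀ a b : E, ⟪a, b⟫_ℝ = (⟪a, b⟫_ℂ).re := fun _ _ => rfl
  let W : Submodule ℝ E := (Submodule.span ℝ P)ᗮ
  have hW : ∀ w, w ∈ W ↔ ∀ ξ ∈ P, (⟪w, ξ⟫_ℂ).re = 0 := by
    intro w
    rw [Submodule.mem_orthogonal']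
    refine ⟨fun h ξ hξ => h ξ (Submodule.subset_span hξ), fun h u hu => ?_⟩
    induction hu using Submodule.span_induction with
    | mem ξ hξ => exact h ξ hξ
    | zero => simp
    | add a b _ _ ha hb => rw [inner_add_right, ha, hb, add_zero]
    | smul t a _ ha => rw [inner_smul_right, ha, mul_zero]
  obtain ⟨w, hw, v, hv, rfl⟩ := W.exists_add_mem_mem_orthogonal x
  refine ⟨v, -Complex.I • w, fun ξ hξ => ?_, fun ξ hξ => ?_, ?_⟩
  · have hmem : Complex.I • ξ ∈ W := by
      rw [hW]
      intro η hη
      rw [inner_smul_left]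
      simp [hP.isRealFor hξ η hη]
    have := W.inner_left_of_mem_orthogonal hmem hv
    rw [hre, inner_smul_right] at this
    simpa using this
  · rw [inner_smul_left]
    simp [(hW w).1 hw ξ hξ]
  · rw [smul_smul]
    simp [add_comm]

lemma eq_zero_of_isRealFor_smul_I (hP : IsSelfDualCone P) {x y : E} (hx : IsRealFor P x)
    (hy : IsRealFor P y) (h : x + Complex.I • y = 0) : x = 0 ∧ y = 0 := by
  have key : ∀ ξ ∈ P, ⟪x, ξ⟫_ℂ = 0 ∧ ⟪y, ξ⟫_ℂ = 0 := by
    intro ξ hξ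
    have h1 : ⟪x + Complex.I • y, ξ⟫_ℂ = 0 := by rw [h, inner_zero_left]
    rw [inner_add_left, inner_smul_left] at h1
    have h2 := congrArg Complex.re h1
    have h3 := congrArg Complex.im h1
    simp [hx ξ hξ, hy ξ hξ] at h2 h3
    exact ⟨Complex.ext h2 (hx ξ hξ), Complex.ext h3 (hy ξ hξ)⟩
  have zero : ∀ z, IsRealFor P z → (∀ ξ ∈ P, ⟪z, ξ⟫_ℂ = 0) → z = 0 := by
    intro z hz h0
    obtain ⟨p, hp, q, hq, hpq, -⟩ := hP.exists_pos_sub_neg hz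
    rw [← inner_self_eq_zero (𝕜 := ℂ)]
    nth_rewrite 2 [hpq]
    rw [inner_sub_right, h0 p hp, h0 q hq, sub_zero]
  exact ⟨zero x hx fun ξ hξ => (key ξ hξ).1, zero y hy fun ξ hξ => (key ξ hξ).2⟩

end IsSelfDualCone

/-! ### The Perron–Frobenius–Faris theorem -/

section PerronFrobenius

variable [CompleteSpace E] {R : E →L[ℂ] E} {μ : ℝ}

/-- If both parts of `x = p - q` were nonzero, the cross terms of `R` would be strictly positive.
Replacing `p - q` by `p + q` keeps the norm but would raise the quadratic form above its bound `μ`.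
So one part vanishes, and applying `R` once makes the other strictly positive. -/
lemma strictlyPositive_of_real_eigenvector (hP : IsSelfDualCone P)
    (hpos : PositivityImproving P R) (hμ : 0 < μ)
    (hbound : ∀ x, (⟪x, R x⟫_ℂ).re ≤ μ * ‖x‖ ^ 2) {x : E} (hx : IsRealFor P x)
    (hRx : R x = (μ : ℂ) • x) (h0 : x ≠ 0) :
    StrictlyPositive P x ∨ StrictlyPositive P (-x) := by
  obtain ⟨p, hp, q, hq, rfl, hpq⟩ := hP.exists_pos_sub_neg hx
  have hqp : ⟪q, p⟫_ℂ = 0 := inner_eq_zero_symm.1 hpq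
  have improve : ∀ y ∈ P, y ≠ 0 → R y = (μ : ℂ) • y → StrictlyPositive P y := by
    intro y hy hy0 hRy
    refine ⟨hy, fun ξ hξ hξ0 => ?_⟩
    have := (hpos y hy hy0).2 ξ hξ hξ0
    rw [hRy, inner_smul_right] at this
    exact pos_of_mul_pos_right this (by exact_mod_cast hμ.le)
  by_cases hp0 : p = 0
  · right
    subst hp0
    simp only [zero_sub, neg_neg] at *
    exact improve q hq (by simpa using h0) (by simpa using hRx)
  by_cases hq0 : q = 0
  · left
    subst hq0
    simp only [sub_zero] at *
    exact improve p hp hp0 hRx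
  exfalso
  have hcross : 0 < (⟪q, R p⟫_ℂ).re := (Complex.pos_iff.1 ((hpos p hp hp0).2 q hq hq0)).1
  have hcross' : 0 < (⟪p, R q⟫_ℂ).re := (Complex.pos_iff.1 ((hpos q hq hq0).2 p hp hp0)).1
  have h1 := hbound (p + q)
  have h2 : (⟪p - q, R (p - q)⟫_ℂ).re = μ * ‖p - q‖ ^ 2 := by
    rw [hRx, inner_smul_right, inner_self_eq_norm_sq_to_K, Complex.re_ofReal_mul]
    norm_cast
  have n1 : ‖p + q‖ ^ 2 = ‖p‖ ^ 2 + ‖q‖ ^ 2 := by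
    rw [@norm_add_sq ℂ, hpq]; simp
  have n2 : ‖p - q‖ ^ 2 = ‖p‖ ^ 2 + ‖q‖ ^ 2 := by
    rw [@norm_sub_sq ℂ, hpq]; simp
  rw [n1] at h1
  rw [n2] at h2
  simp only [map_add, map_sub, inner_add_left, inner_add_right, inner_sub_left, inner_sub_right,
    Complex.add_re, Complex.sub_re] at h1 h2
  linarith

/-- `R` preserves real vectors, so the real and imaginary parts of an eigenvector are eigenvectors
too. They are proportional, because two strictly positive vectors are never orthogonal. -/
lemma exists_smul_strictlyPositive (hP : IsSelfDualCone P) (hR : R.IsSymmetric)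
    (hpos : PositivityImproving P R) (hμ : 0 < μ)
    (hbound : ∀ x, (⟪x, R x⟫_ℂ).re ≤ μ * ‖x‖ ^ 2) {x : E}
    (hRx : R x = (μ : ℂ) • x) (h0 : x ≠ 0) :
    ∃ (c : ℂ) (y : E), StrictlyPositive P y ∧ y ≠ 0 ∧ R y = (μ : ℂ) • y ∧ x = c • y := by
  have hRP : ∀ ξ ∈ P, R ξ ∈ P := by
    intro ξ hξ
    by_cases h : ξ = 0
    · rw [h, map_zero]; exact hP.zero_mem
    · exact (hpos ξ hξ h).1
  have real_map : ∀ a, IsRealFor P a → IsRealFor P (R a) := by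
    intro a ha ξ hξ
    have : ⟪R a, ξ⟫_ℂ = ⟪a, R ξ⟫_ℂ := hR a ξ
    rw [this]
    exact ha _ (hRP ξ hξ)
  have positive : ∀ b, IsRealFor P b → R b = (μ : ℂ) • b → b ≠ 0 →
      ∃ (s : ℂ) (y : E), StrictlyPositive P y ∧ y ≠ 0 ∧ R y = (μ : ℂ) • y ∧ b = s • y := by
    intro b hb hRb hb0
    rcases strictlyPositive_of_real_eigenvector hP hpos hμ hbound hb hRb hb0 with h | h
    · exact ⟨1, b, h, hb0, hRb, by simp⟩
    · exact ⟨-1, -b, h, neg_ne_zero.2 hb0, by simp [hRb], by simp⟩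
  obtain ⟨a, b, ha, hb, rfl⟩ := hP.exists_re_add_im x
  have hab : R a = (μ : ℂ) • a ∧ R b = (μ : ℂ) • b := by
    have h := hP.eq_zero_of_isRealFor_smul_I (x := R a - (μ : ℂ) • a) (y := R b - (μ : ℂ) • b)
      ((real_map a ha).sub_smul ha μ) ((real_map b hb).sub_smul hb μ) (by
        rw [map_add, map_smul, smul_add, smul_comm (μ : ℂ)] at hRx
        rw [smul_sub, sub_add_sub_comm, hRx, sub_self])
    exact ⟨sub_eq_zero.1 h.1, sub_eq_zero.1 h.2⟩
  by_cases hb0 : b = 0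
  · subst hb0
    simp only [smul_zero, add_zero] at h0 ⊢
    exact positive a ha hab.1 h0
  obtain ⟨s, y, hy, hy0, hRy, hby⟩ := positive b hb hab.2 hb0
  have hyr := hP.isRealFor hy.1
  obtain ⟨t, ht⟩ : ∃ t : ℝ, ⟪y, a - (t : ℂ) • y⟫_ℂ = 0 := by
    have him : (⟪y, a⟫_ℂ).im = 0 := by
      rw [← inner_conj_symm, Complex.conj_im, ha y hy.1, neg_zero]
    refine ⟨(⟪y, a⟫_ℂ).re / ‖y‖ ^ 2, ?_⟩
    have hre : ⟪y, a⟫_ℂ = ((⟪y, a⟫_ℂ).re : ℂ) := Complex.ext rfl (by simpa using him)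
    have hn : (‖y‖ : ℂ) ^ 2 ≠ 0 := by simpa using hy0
    rw [inner_sub_right, inner_smul_right, inner_self_eq_norm_sq_to_K]
    nth_rewrite 1 [hre]
    push_cast
    simp only [Complex.coe_algebraMap]
    rw [div_mul_cancel₀ _ hn, sub_self]
  have hat : a - (t : ℂ) • y = 0 := by
    by_contra hne
    obtain ⟨r, z, hz, hz0, -, haz⟩ := positive _ (ha.sub_smul hyr t)
      (by rw [map_sub, map_smul, hab.1, hRy, smul_sub, smul_comm]) hne
    rw [haz, inner_smul_right] at ht
    rcases mul_eq_zero.1 ht with h | h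
    · exact hne (by rw [haz, h, zero_smul])
    · exact (hz.2 y hy.1 hy0).ne' h
  exact ⟨t + Complex.I * s, y, hy, hy0, hRy, by
    rw [sub_eq_zero.1 hat, hby, add_smul, smul_smul]⟩

/-- The eigenvectors of a positivity improving symmetric operator for the top of its numerical
range are multiples of one strictly positive vector. -/
theorem exists_strictlyPositive_eigenvector (hP : IsSelfDualCone P) (hR : R.IsSymmetric)
    (hpos : PositivityImproving P R) (hμ : 0 < μ)
    (hbound : ∀ x, (⟪x, R x⟫_ℂ).re ≤ μ * ‖x‖ ^ 2) {x : E}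
    (hRx : R x = (μ : ℂ) • x) (h0 : x ≠ 0) :
    ∃ y, StrictlyPositive P y ∧ y ≠ 0 ∧ ∀ z, R z = (μ : ℂ) • z → ∃ c : ℂ, z = c • y := by
  obtain ⟨-, y, hy, hy0, hRy, -⟩ :=
    exists_smul_strictlyPositive hP hR hpos hμ hbound hRx h0
  refine ⟨y, hy, hy0, fun z hz => ⟨⟪y, z⟫_ℂ / ⟪y, y⟫_ℂ, ?_⟩⟩
  by_contra hne
  have hyy : ⟪y, y⟫_ℂ ≠ 0 := by simpa using hy0
  -- The component orthogonal to `y` is again an eigenvector; if nonzero, it would be a multiple of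
  -- a strictly positive vector, whose overlap with `y` cannot vanish.
  set w := z - (⟪y, z⟫_ℂ / ⟪y, y⟫_ℂ) • y with hw
  have hyw : ⟪y, w⟫_ℂ = 0 := by
    rw [hw, inner_sub_right, inner_smul_right, div_mul_cancel₀ _ hyy, sub_self]
  have hw0 : w ≠ 0 := sub_ne_zero.2 hne
  obtain ⟨c, v, hv, -, -, hwv⟩ := exists_smul_strictlyPositive hP hR hpos hμ hbound
    (x := w) (by rw [hw, map_sub, map_smul, hz, hRy, smul_sub, smul_comm]) hw0
  rw [hwv, inner_smul_right] at hyw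
  rcases mul_eq_zero.1 hyw with h | h
  · exact hw0 (by rw [hwv, h, zero_smul])
  · exact (hv.2 y hy.1 hy0).ne' h

end PerronFrobenius

end Cones


/-! ### Resolvents and the ground state of an operator with positivity improving resolvent -/

section Unbounded

variable {E : Type*} [NormedAddCommGroup E] [InnerProductSpace ℂ E] {H : E →ₗ.[ℂ] E}

lemma mem_eigenspace_iff {z : ℂ} {x : E} :
    x ∈ eigenspace H z ↔ ∃ h : x ∈ H.domain, H ⟨x, h⟩ = z • x := by
  simp only [eigenspace, Submodule.mem_map, LinearMap.mem_ker, LinearMap.sub_apply,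
    LinearMap.smul_apply, Submodule.subtype_apply, sub_eq_zero]
  constructor
  · rintro ⟨y, hy, rfl⟩
    exact ⟨y.2, hy⟩
  · rintro ⟨h, hx⟩
    exact ⟨⟨x, h⟩, hx, rfl⟩

lemma IsResolventAt.apply_of_mem_eigenspace {z w : ℂ} {R : E →L[ℂ] E} (hR : IsResolventAt H z R)
    {x : E} (hx : x ∈ eigenspace H w) (hwz : w ≠ z) : R x = (w - z)⁻¹ • x := by
  obtain ⟨h, hx⟩ := mem_eigenspace_iff.1 hx
  have := hR.2 ⟨x, h⟩
  rw [hx, ← sub_smul, map_smul] at this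
  rw [eq_inv_smul_iff₀ (sub_ne_zero.2 hwz)]
  exact this

lemma mem_spec_of_eigenspace_ne_bot {z : ℂ} (h : eigenspace H z ≠ ⊥) : z ∈ spec H := by
  rintro ⟨R, hR⟩
  obtain ⟨x, hx, hx0⟩ := Submodule.exists_mem_ne_zero_of_ne_bot h
  obtain ⟨hd, hx⟩ := mem_eigenspace_iff.1 hx
  have := hR.2 ⟨x, hd⟩
  rw [hx, sub_self, map_zero] at this
  exact hx0 this.symm

/-- If `μ ≠ 0` is in the spectrum of the resolvent `(H - z)⁻¹`, then `z + μ⁻¹` is in the spectrum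
of `H`. -/
lemma IsResolventAt.add_inv_mem_spec {z μ : ℂ} {R : E →L[ℂ] E} (hR : IsResolventAt H z R)
    (hμ : μ ≠ 0) (hmem : μ ∈ spectrum ℂ R) : z + μ⁻¹ ∈ spec H := by
  rintro ⟨Q, hQ⟩
  -- Formally `(μ - R)⁻¹ = μ⁻¹ (H - z) (H - z - μ⁻¹)⁻¹ = μ⁻¹ (1 + μ⁻¹ Q)`.
  refine hmem (isUnit_iff_exists.2 ⟨μ⁻¹ • (1 + μ⁻¹ • Q), ?_, ?_⟩)
  · ext y
    obtain ⟨hd, hy⟩ := hQ.1 y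
    have h := hR.2 ⟨Q y, hd⟩
    have e : H ⟨Q y, hd⟩ - z • Q y = y + μ⁻¹ • Q y := by
      rw [add_smul, ← sub_sub, sub_eq_iff_eq_add] at hy
      exact hy
    simp only at h
    rw [e] at h
    simp only [Algebra.algebraMap_eq_smul_one]
    change μ • (μ⁻¹ • (y + μ⁻¹ • Q y)) - R (μ⁻¹ • (y + μ⁻¹ • Q y)) = y
    rw [map_smul, h, smul_inv_smul₀ hμ, add_sub_cancel_right]
  · ext y
    obtain ⟨hd, hy⟩ := hR.1 y
    have h := hQ.2 ⟨R y, hd⟩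
    have e : H ⟨R y, hd⟩ - (z + μ⁻¹) • R y = y - μ⁻¹ • R y := by
      rw [add_smul, ← sub_sub, hy]
    simp only at h
    rw [e, map_sub, map_smul] at h
    simp only [Algebra.algebraMap_eq_smul_one]
    change μ⁻¹ • ((μ • y - R y) + μ⁻¹ • Q (μ • y - R y)) = y
    have h' : μ⁻¹ • Q (μ • y - R y) = R y := by
      rw [map_sub, map_smul, smul_sub, inv_smul_smul₀ hμ, h]
    rw [h', sub_add_cancel, inv_smul_smul₀ hμ]

variable [CompleteSpace E]

lemma inner_apply_of_isSelfAdjoint (hH : IsSelfAdjoint H) (x y : H.domain) :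
    ⟪H x, (y : E)⟫_ℂ = ⟪(x : E), H y⟫_ℂ := by
  have h := LinearPMap.adjoint_isFormalAdjoint hH.dense_domain
  rw [LinearPMap.isSelfAdjoint_def.1 hH] at h
  exact h x y

lemma IsResolventAt.isSymmetric (hH : IsSelfAdjoint H) {s : ℝ} {R : E →L[ℂ] E}
    (hR : IsResolventAt H (s : ℂ) R) : R.IsSymmetric := by
  intro x y
  obtain ⟨hx, ex⟩ := hR.1 x
  obtain ⟨hy, ey⟩ := hR.1 y
  change ⟪R x, y⟫_ℂ = ⟪x, R y⟫_ℂ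
  conv_lhs => rw [← ey]
  conv_rhs => rw [← ex]
  rw [inner_sub_right, inner_sub_left, inner_smul_right, inner_smul_left,
    inner_apply_of_isSelfAdjoint hH ⟨R x, hx⟩ ⟨R y, hy⟩, Complex.conj_ofReal]

variable {P : Set E}

namespace HasPositivityImprovingResolvent

/-- The lower bound comes from the resolvents, which exist at every real point below `E(H)`; thus no
property of `sInf` is needed. -/
lemma groundEnergy_le (hH : HasPositivityImprovingResolvent P H) {r : ℝ}
    (hr : (r : ℂ) ∈ spec H) : groundEnergy H ≤ r := by
  by_contra hlt
  obtain ⟨R, hR, -⟩ := hH.improving (-r) (by linarith)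
  exact hr ⟨R, by simpa using hR⟩

/-- The ground state energy is an eigenvalue, and `‖(H + s)⁻¹‖ = (E(H) + s)⁻¹`. -/
lemma groundEnergy_mem_spec [Nontrivial E] (hH : HasPositivityImprovingResolvent P H) {s : ℝ}
    (hs : -groundEnergy H < s) {R : E →L[ℂ] E} (hR : IsResolventAt H (-(s : ℂ)) R) :
    (groundEnergy H : ℂ) ∈ spec H ∧ ‖R‖ = (groundEnergy H + s)⁻¹ := by
  have hsymm : R.IsSymmetric :=
    IsResolventAt.isSymmetric (s := -s) hH.isSelfAdjoint (by push_cast; exact hR)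
  have hsa : IsSelfAdjoint R := ContinuousLinearMap.isSelfAdjoint_iff_isSymmetric.2 hsymm
  have hR0 : R ≠ 0 := by
    rintro rfl
    obtain ⟨y, hy⟩ := exists_ne (0 : E)
    obtain ⟨hd, hy'⟩ := hR.1 y
    have h0 : H ⟨(0 : E →L[ℂ] E) y, hd⟩ = 0 := by
      rw [← H.map_zero]; rfl
    rw [h0] at hy'
    simp at hy'
    exact hy hy'.symm
  -- For self-adjoint `R` the spectral radius is the norm, so some real spectral value has modulus
  -- `‖R‖`.
  obtain ⟨μ, hμ, hnorm⟩ := spectrum.exists_nnnorm_eq_spectralRadius R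
  rw [hsa.spectralRadius_eq_nnnorm] at hnorm
  have hnorm' : ‖μ‖ = ‖R‖ := by
    have : ‖μ‖₊ = ‖R‖₊ := by exact_mod_cast hnorm
    exact congrArg NNReal.toReal this
  have hRpos : 0 < ‖R‖ := norm_pos_iff.2 hR0
  have hμre := hsa.mem_spectrum_eq_re hμ
  set m : ℝ := μ.re
  have hm0 : μ ≠ 0 := norm_pos_iff.1 (hnorm'.symm ▸ hRpos)
  have hz := hR.add_inv_mem_spec hm0 hμ
  have hzr : -(s : ℂ) + μ⁻¹ = ((m⁻¹ - s : ℝ) : ℂ) := by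
    rw [hμre]; push_cast; ring
  rw [hzr] at hz
  have hEle := hH.groundEnergy_le hz
  -- The sign of `m` is settled by `m⁻¹ - s ∈ spec H`, which gives `m⁻¹ ≥ E(H) + s > 0`.
  have hmpos : 0 < m := inv_pos.1 (by linarith)
  have hmR : m = ‖R‖ := by
    rw [← hnorm', hμre, Complex.norm_real, Real.norm_of_nonneg hmpos.le]
  have hE : groundEnergy H = m⁻¹ - s := by
    refine le_antisymm hEle (le_csInf ⟨_, hz⟩ fun r hr => ?_)
    have hrs : 0 < r + s := by
      have := hH.groundEnergy_le hr
      linarith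
    obtain ⟨x, hx, hx0⟩ := Submodule.exists_mem_ne_zero_of_ne_bot (hH.discrete _ hr).2.1
    have hrs' : (r : ℂ) - -(s : ℂ) = ((r + s : ℝ) : ℂ) := by push_cast; ring
    have hRx := hR.apply_of_mem_eigenspace hx (by
      rw [← sub_ne_zero, hrs']; exact_mod_cast hrs.ne')
    have hle := R.le_opNorm x
    rw [hRx, hrs', norm_smul, norm_inv, Complex.norm_real, Real.norm_of_nonneg hrs.le] at hle
    have hle' := le_of_mul_le_mul_right hle (norm_pos_iff.2 hx0)
    rw [← hmR] at hle'
    have := (inv_le_comm₀ hrs hmpos).1 hle'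
    linarith
  refine ⟨by rw [hE]; exact hz, ?_⟩
  rw [hE, sub_add_cancel, inv_inv, hmR]

/-- The ground state is unique and strictly positive. -/
theorem exists_groundState [Nontrivial E] (hP : IsSelfDualCone P)
    (hH : HasPositivityImprovingResolvent P H) :
    ∃ ψ, StrictlyPositive P ψ ∧ ψ ≠ 0 ∧ eigenspace H (groundEnergy H : ℂ) = ℂ ∙ ψ := by
  obtain ⟨s, hs⟩ := exists_gt (-groundEnergy H)
  obtain ⟨R, hR, hpos⟩ := hH.improving s hs
  have hEs : 0 < groundEnergy H + s := by linarith
  obtain ⟨hspec, hnorm⟩ := hH.groundEnergy_mem_spec hs hR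
  obtain ⟨x, hx, hx0⟩ := Submodule.exists_mem_ne_zero_of_ne_bot (hH.discrete _ hspec).2.1
  have hsymm : R.IsSymmetric :=
    IsResolventAt.isSymmetric (s := -s) hH.isSelfAdjoint (by push_cast; exact hR)
  have heig : ∀ y ∈ eigenspace H (groundEnergy H : ℂ),
      R y = (((groundEnergy H + s)⁻¹ : ℝ) : ℂ) • y := by
    intro y hy
    have hrs' : (groundEnergy H : ℂ) - -(s : ℂ) = ((groundEnergy H + s : ℝ) : ℂ) := by
      push_cast; ring
    rw [hR.apply_of_mem_eigenspace hy (by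
      rw [← sub_ne_zero, hrs']; exact_mod_cast hEs.ne'), hrs', Complex.ofReal_inv]
  have hbound : ∀ x, (⟪x, R x⟫_ℂ).re ≤ (groundEnergy H + s)⁻¹ * ‖x‖ ^ 2 := by
    intro x
    calc (⟪x, R x⟫_ℂ).re ≤ ‖x‖ * ‖R x‖ := re_inner_le_norm (𝕜 := ℂ) x (R x)
      _ ≤ ‖x‖ * (‖R‖ * ‖x‖) := by gcongr; exact R.le_opNorm x
      _ = (groundEnergy H + s)⁻¹ * ‖x‖ ^ 2 := by rw [hnorm]; ring
  obtain ⟨ψ, hψ, hψ0, hall⟩ := exists_strictlyPositive_eigenvector hP hsymm hpos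
    (inv_pos.2 hEs) hbound (heig x hx) hx0
  refine ⟨ψ, hψ, hψ0, le_antisymm (fun y hy => ?_) ?_⟩
  · obtain ⟨c, rfl⟩ := hall y (heig y hy)
    exact Submodule.smul_mem _ _ (Submodule.mem_span_singleton_self ψ)
  · obtain ⟨c, hc⟩ := hall x (heig x hx)
    have hc0 : c ≠ 0 := by
      rintro rfl
      exact hx0 (by simpa using hc)
    rw [Submodule.span_singleton_le_iff_mem]
    have := Submodule.smul_mem _ c⁻¹ hx
    rwa [hc, inv_smul_smul₀ hc0] at this

end HasPositivityImprovingResolvent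

/-- Eigenspaces of finite dimension are invariant under bounded operators that commute strongly. -/
lemma StronglyCommutes.apply_mem_eigenspace {O : E →L[ℂ] E} (hO : StronglyCommutes O H) {z : ℂ}
    [FiniteDimensional ℂ (eigenspace H z)] {x : E} (hx : x ∈ eigenspace H z) :
    O x ∈ eigenspace H z := by
  obtain ⟨U, hU, hcomm⟩ := hO
  obtain ⟨hd, hHx⟩ := mem_eigenspace_iff.1 hx
  have hmem : ∀ s : ℝ, NormedSpace.exp ((Complex.I * (s : ℂ)) • O) x ∈ eigenspace H z := by
    intro s
    have hder := (hU.generator x _).2 ⟨hd, rfl⟩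
    set V := NormedSpace.exp ((Complex.I * (s : ℂ)) • O)
    -- Commuting `V` past `U t` differentiates the orbit of `V x`; the description of the generator
    -- then yields both `V x ∈ H.domain` and `H V x = V H x`.
    have hder' : HasDerivAt (fun t : ℝ => U t (V x)) (V (Complex.I • H ⟨x, hd⟩)) 0 := by
      have h := (V.restrictScalars ℝ).hasFDerivAt.comp_hasDerivAt (0 : ℝ) hder
      refine h.congr_of_eventuallyEq (Filter.Eventually.of_forall fun t => ?_)
      exact (congrArg (fun T : E →L[ℂ] E => T x) (hcomm s t)).symm
    obtain ⟨hd', h⟩ := (hU.generator _ _).1 hder'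
    refine mem_eigenspace_iff.2 ⟨hd', ?_⟩
    rw [map_smul] at h
    rw [← smul_right_injective E Complex.I_ne_zero h, hHx, map_smul]
  have hder : HasDerivAt (fun s : ℝ => NormedSpace.exp ((Complex.I * (s : ℂ)) • O) x)
      ((Complex.I • O) x) 0 := by
    have h := hasDerivAt_exp_smul_const (𝕂 := ℝ) (Complex.I • O) (0 : ℝ)
    rw [zero_smul, NormedSpace.exp_zero, one_mul] at h
    have h' := ((ContinuousLinearMap.apply ℂ E x).restrictScalars ℝ).hasFDerivAt.comp_hasDerivAt
      (0 : ℝ) h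
    refine h'.congr_of_eventuallyEq (Filter.Eventually.of_forall fun t => ?_)
    change _ = NormedSpace.exp (t • Complex.I • O) x
    simp only [mul_comm Complex.I, mul_smul, Complex.coe_smul]
  have hI : (Complex.I • O) x ∈ eigenspace H z := by
    -- Difference quotients of `exp(isO) x` stay in the eigenspace, which is closed because it is
    -- finite-dimensional, so the derivative `iOx` lies there as well.
    have hcl : IsClosed (eigenspace H z : Set E) := Submodule.closed_of_finiteDimensional _
    refine hcl.mem_of_tendsto hder.tendsto_slope (Filter.Eventually.of_forall fun s => ?_)
    rw [slope_def_module]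
    exact Submodule.smul_of_tower_mem _ _ (Submodule.sub_mem _ (hmem _) (hmem _))
  have := Submodule.smul_mem _ (-Complex.I) hI
  rwa [smul_apply, smul_smul, neg_mul, Complex.I_mul_I, neg_neg,
    one_smul] at this

end Unbounded

/-! ### The quantum number of the ground state is constant on stability classes -/

section Stability

variable {X : Type u} [NormedAddCommGroup X] [InnerProductSpace ℂ X] [CompleteSpace X]

/-- Since `κ = τ ι` and `τ` is isometric, `κ* τ = ι*`. -/
lemma naturalExtension_comp {F G : Type*} [NormedAddCommGroup F] [InnerProductSpace ℂ F]
    [CompleteSpace F] [NormedAddCommGroup G] [InnerProductSpace ℂ G] [CompleteSpace G]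
    {ι : X →ₗᵢ[ℂ] F} {κ : X →ₗᵢ[ℂ] G} {τ : F →ₗᵢ[ℂ] G} (h : ∀ x, τ (ι x) = κ x) (O : X →L[ℂ] X)
    (x : F) : naturalExtension κ O (τ x) = τ (naturalExtension ι O x) := by
  have hadj : ContinuousLinearMap.adjoint κ.toContinuousLinearMap (τ x) =
      ContinuousLinearMap.adjoint ι.toContinuousLinearMap x := by
    refine ext_inner_right ℂ fun y => ?_
    rw [ContinuousLinearMap.adjoint_inner_left, ContinuousLinearMap.adjoint_inner_left]
    simp only [LinearIsometry.coe_toContinuousLinearMap]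
    rw [← h, LinearIsometry.inner_map_map]
  simp only [naturalExtension, ContinuousLinearMap.comp_apply, hadj,
    LinearIsometry.coe_toContinuousLinearMap, h]

lemma naturalExtension_isSymmetric {F : Type*} [NormedAddCommGroup F] [InnerProductSpace ℂ F]
    [CompleteSpace F] (ι : X →ₗᵢ[ℂ] F) {O : X →L[ℂ] X} (hO : ∀ x y, ⟪O x, y⟫_ℂ = ⟪x, O y⟫_ℂ) :
    (naturalExtension ι O).IsSymmetric := by
  intro x y
  change ⟪naturalExtension ι O x, y⟫_ℂ = ⟪x, naturalExtension ι O y⟫_ℂ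
  simp only [naturalExtension, ContinuousLinearMap.comp_apply]
  rw [← ContinuousLinearMap.adjoint_inner_right ι.toContinuousLinearMap,
    ← ContinuousLinearMap.adjoint_inner_left ι.toContinuousLinearMap]
  exact hO _ _

/-- The ground state of an admissible Hamiltonian is simple and an eigenvector of `O`. -/
lemma exists_quantumNumber [Nontrivial X] {O : X →L[ℂ] X} {K : Hamiltonian X}
    (hcomm : StronglyCommutes (naturalExtension K.incl O) K.op) {P : Set K.space}
    (hP : IsSelfDualCone P) (hK : HasPositivityImprovingResolvent P K.op) :
    ∃ ψ, StrictlyPositive P ψ ∧ ψ ≠ 0 ∧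
      eigenspace K.op (groundEnergy K.op : ℂ) = ℂ ∙ ψ ∧
      ∃ c : ℂ, naturalExtension K.incl O ψ = c • ψ := by
  have : Nontrivial K.space := K.incl.injective.nontrivial
  obtain ⟨ψ, hψ, hψ0, hspan⟩ := hK.exists_groundState hP
  have : FiniteDimensional ℂ (eigenspace K.op (groundEnergy K.op : ℂ)) := by
    rw [hspan]; infer_instance
  have hmem := hcomm.apply_mem_eigenspace (z := (groundEnergy K.op : ℂ)) (x := ψ)
    (by rw [hspan]; exact Submodule.mem_span_singleton_self ψ)
  rw [hspan, Submodule.mem_span_singleton] at hmem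
  obtain ⟨c, hc⟩ := hmem
  exact ⟨ψ, hψ, hψ0, hspan, c, hc.symm⟩

/-- Symmetry of `O` gives `m ⟪τψ₁, ψ₂⟫ = c ⟪τψ₁, ψ₂⟫` with nonzero overlap. The conclusion mentions
no cone, so the cone may change between steps. -/
lemma Step.hasGroundStateQuantumNumber [Nontrivial X] {O : X →L[ℂ] X} (hO : ∀ x y, ⟪O x, y⟫_ℂ = ⟪x, O y⟫_ℂ)
    {K₁ K₂ : Hamiltonian X} (h₁ : K₁ ∈ admissible O) (h₂ : K₂ ∈ admissible O)
    (hstep : Step K₁ K₂) {m : ℝ} (hm : HasGroundStateQuantumNumber O K₁ m) :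
    HasGroundStateQuantumNumber O K₂ m := by
  obtain ⟨τ, P₁, P₂, hτ, hP₁, hP₂, hK₁, hK₂, himage, hπ⟩ := hstep
  obtain ⟨ψ₁, hψ₁, hψ₁0, hspan₁, -⟩ := exists_quantumNumber h₁.2 hP₁ hK₁
  obtain ⟨ψ₂, hψ₂, hψ₂0, hspan₂, c, hc⟩ := exists_quantumNumber h₂.2 hP₂ hK₂
  have hOψ₁ := hm.2 ψ₁ (by rw [hspan₁]; exact Submodule.mem_span_singleton_self ψ₁)
  -- Write `ψ₁ = τ* ξ` with `ξ ∈ P₂`; then `τ ψ₁ = π ξ`, and `π` preserves `P₂`.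
  have hτψ₁ : τ ψ₁ ∈ P₂ := by
    have h := hψ₁.1
    rw [himage] at h
    obtain ⟨ξ, hξ, hξψ⟩ := h
    have := hπ ξ hξ
    rwa [ContinuousLinearMap.comp_apply, hξψ] at this
  have hpos : ⟪τ ψ₁, ψ₂⟫_ℂ ≠ 0 :=
    (hψ₂.2 _ hτψ₁ ((map_ne_zero_iff τ τ.injective).2 hψ₁0)).ne'
  have hcm : c = m := by
    have h : ⟪naturalExtension K₂.incl O (τ ψ₁), ψ₂⟫_ℂ =
        ⟪τ ψ₁, naturalExtension K₂.incl O ψ₂⟫_ℂ :=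
      naturalExtension_isSymmetric K₂.incl hO _ _
    rw [naturalExtension_comp hτ, hOψ₁, hc, map_smul, inner_smul_left, inner_smul_right,
      Complex.conj_ofReal] at h
    exact (mul_right_cancel₀ hpos h).symm
  refine ⟨by rw [hspan₂]; exact finrank_span_singleton hψ₂0, fun ψ hψ => ?_⟩
  rw [hspan₂, Submodule.mem_span_singleton] at hψ
  obtain ⟨a, rfl⟩ := hψ
  rw [map_smul, hc, hcm, smul_comm]

lemma Connected.hasGroundStateQuantumNumber [Nontrivial X] {O : X →L[ℂ] X}
    (hO : ∀ x y, ⟪O x, y⟫_ℂ = ⟪x, O y⟫_ℂ) {K K' : Hamiltonian X} (h : Connected O K K') {m : ℝ}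
    (hm : HasGroundStateQuantumNumber O K m) : HasGroundStateQuantumNumber O K' m := by
  induction h with
  | single h => exact h.2.2.hasGroundStateQuantumNumber hO h.1 h.2.1 hm
  | tail _ h ih => exact h.2.2.hasGroundStateQuantumNumber hO h.1 h.2.1 ih

/-- Supplies the admissibility of `H_MLM`, for which no cone is constructed here. -/
lemma Connected.left_mem_admissible {O : X →L[ℂ] X} {K K' : Hamiltonian X}
    (h : Connected O K K') : K ∈ admissible O := by
  induction h with
  | single h => exact h.1
  | tail _ _ ih => exact ih

/-- A joint eigenvector of `K` and `O`, the eigenvalue of `K` being the lowest one, determines the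
quantum number of `K`. -/
lemma hasGroundStateQuantumNumber_of_lowest [Nontrivial X] {O : X →L[ℂ] X} {K : Hamiltonian X}
    (hK : K ∈ admissible O) {e m : ℝ} {ψ : K.space} (hψ0 : ψ ≠ 0)
    (hψ : ψ ∈ eigenspace K.op (e : ℂ)) (hOψ : naturalExtension K.incl O ψ = (m : ℂ) • ψ)
    (hmin : ∀ (r : ℝ) (φ : K.space), φ ≠ 0 → φ ∈ eigenspace K.op (r : ℂ) → e ≤ r) :
    HasGroundStateQuantumNumber O K m := by
  obtain ⟨⟨P, hP, hK⟩, hcomm⟩ := hK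
  obtain ⟨χ, -, hχ0, hspan, -⟩ := exists_quantumNumber hcomm hP hK
  have he : groundEnergy K.op = e := by
    refine le_antisymm (hK.groundEnergy_le (mem_spec_of_eigenspace_ne_bot ?_))
      (hmin _ χ hχ0 (by rw [hspan]; exact Submodule.mem_span_singleton_self χ))
    exact (Submodule.ne_bot_iff _).2 ⟨ψ, hψ, hψ0⟩
  have hψχ : ψ ∈ ℂ ∙ χ := by
    rwa [← hspan, he]
  have hspan' : eigenspace K.op (groundEnergy K.op : ℂ) = ℂ ∙ ψ := by
    rw [hspan]
    obtain ⟨a, rfl⟩ := Submodule.mem_span_singleton.1 hψχ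
    have ha : a ≠ 0 := by
      rintro rfl
      exact hψ0 (zero_smul _ _)
    exact (Submodule.span_singleton_smul_eq (IsUnit.mk0 a ha) χ).symm
  refine ⟨by rw [hspan']; exact finrank_span_singleton hψ0, fun φ hφ => ?_⟩
  rw [hspan', Submodule.mem_span_singleton] at hφ
  obtain ⟨a, rfl⟩ := hφ
  rw [map_smul, hOψ, smul_comm]

lemma naturalExtension_id (O : X →L[ℂ] X) : naturalExtension LinearIsometry.id O = O := by
  ext x
  have : ContinuousLinearMap.adjoint
      (LinearIsometry.id : X →ₗᵢ[ℂ] X).toContinuousLinearMap x = x := by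
    refine ext_inner_right ℂ fun y => ?_
    rw [ContinuousLinearMap.adjoint_inner_left]
    simp
  simp only [naturalExtension, ContinuousLinearMap.comp_apply, this]
  simp

lemma hasGroundStateQuantumNumber_ofCLM [Nontrivial X] {O T : X →L[ℂ] X}
    (hT : Hamiltonian.ofCLM T ∈ admissible O) {e m : ℝ} {ψ : X} (hψ0 : ψ ≠ 0)
    (hTψ : T ψ = (e : ℂ) • ψ) (hOψ : O ψ = (m : ℂ) • ψ)
    (hmin : ∀ (r : ℝ) (φ : X), φ ≠ 0 → T φ = (r : ℂ) • φ → e ≤ r) :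
    HasGroundStateQuantumNumber O (Hamiltonian.ofCLM T) m := by
  have hext : naturalExtension (LinearIsometry.id : X →ₗᵢ[ℂ] X) O ψ = (m : ℂ) • ψ := by
    rw [naturalExtension_id, hOψ]
  refine hasGroundStateQuantumNumber_of_lowest hT hψ0 (mem_eigenspace_iff.2 ⟨trivial, hTψ⟩) hext
    fun r φ hφ0 hφ => ?_
  obtain ⟨_, h⟩ := mem_eigenspace_iff.1 hφ
  exact hmin r φ hφ0 h

end Stability


/-! ### Exchange of spins -/

section Exchange

variable {Λ : Type u}

/-- The number of sites of `A` at which the spin is up. -/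
def countUp (A : Finset Λ) (σ : Λ → Fin 2) : ℕ := (A.filter fun x => σ x = 0).card

lemma countUp_le (A : Finset Λ) (σ : Λ → Fin 2) : countUp A σ ≤ A.card :=
  Finset.card_filter_le _ _

lemma sum_apply_eq_countUp {R : Type*} [CommRing R] (A : Finset Λ) (σ : Λ → Fin 2)
    (F : Fin 2 → R) :
    ∑ x ∈ A, F (σ x) = countUp A σ * F 0 + (A.card - countUp A σ) * F 1 := by
  have h : ∀ x ∈ A, F (σ x) = F 1 + if σ x = 0 then F 0 - F 1 else 0 := by
    intro x _
    rcases Fin.exists_fin_two.1 ⟨σ x, rfl⟩ with h0 | h0 <;> simp [h0]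
  rw [Finset.sum_congr rfl h, Finset.sum_add_distrib, ← Finset.sum_filter, Finset.sum_const,
    Finset.sum_const, nsmul_eq_mul, nsmul_eq_mul, countUp]
  ring

variable [DecidableEq Λ]

/-- `σ` with the spins at the sites `x` and `y` exchanged. -/
def exchange (x y : Λ) (σ : Λ → Fin 2) : Λ → Fin 2 := fun z => σ (Equiv.swap x y z)

lemma exchange_exchange (x y : Λ) (σ : Λ → Fin 2) : exchange x y (exchange x y σ) = σ := by
  funext z
  simp [exchange]

lemma exchange_of_eq {x y : Λ} {σ : Λ → Fin 2} (h : σ x = σ y) : exchange x y σ = σ := by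
  funext z
  simp only [exchange, Equiv.swap_apply_def]
  split_ifs with h1 h2
  · rw [h1, h]
  · rw [h2, h]
  · rfl

lemma exchange_eq_update {x y : Λ} (σ : Λ → Fin 2) :
    exchange x y σ = Function.update (Function.update σ x (σ y)) y (σ x) := by
  funext z
  simp only [exchange, Equiv.swap_apply_def, Function.update_apply]
  split_ifs <;> simp_all

lemma countUp_union {A B : Finset Λ} (h : Disjoint A B) (σ : Λ → Fin 2) :
    countUp (A ∪ B) σ = countUp A σ + countUp B σ := by
  rw [countUp, Finset.filter_union, Finset.card_union_of_disjoint
    (Finset.disjoint_filter_filter h)]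
  rfl

lemma countUp_exchange_of_mem_iff {A : Finset Λ} {x y : Λ} (h : x ∈ A ↔ y ∈ A)
    (σ : Λ → Fin 2) : countUp A (exchange x y σ) = countUp A σ := by
  simp only [countUp, Finset.card_filter]
  refine Finset.sum_equiv (Equiv.swap x y) (fun z => ?_) fun z _ => rfl
  rw [Equiv.swap_apply_def]
  split_ifs with h1 h2
  · rw [h1, h]
  · rw [h2, h]
  · rfl

/-- Only the spin at `x` changes inside `A`. The balance is written additively to avoid truncated
subtraction. -/
lemma countUp_exchange_add {A : Finset Λ} {x y : Λ} (hx : x ∈ A) (hy : y ∉ A) (σ : Λ → Fin 2) :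
    countUp A (exchange x y σ) + (if σ x = 0 then 1 else 0) =
      countUp A σ + if σ y = 0 then 1 else 0 := by
  simp only [countUp, Finset.card_filter]
  rw [← Finset.add_sum_erase A _ hx, ← Finset.add_sum_erase A _ hx]
  have h : ∀ z ∈ A.erase x, (if exchange x y σ z = 0 then 1 else 0) =
      if σ z = 0 then 1 else 0 := by
    intro z hz
    rw [exchange, Equiv.swap_apply_of_ne_of_ne (Finset.ne_of_mem_erase hz)]
    rintro rfl
    exact hy (Finset.mem_of_mem_erase hz)
  rw [Finset.sum_congr rfl h, exchange, Equiv.swap_apply_left]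
  ring

end Exchange

/-! ### The spin operators in terms of exchanges -/

section Spin

variable {Λ : Type u} [Fintype Λ] [DecidableEq Λ]

/-- `S_x · S_y = P_{xy} / 2 - 1 / 4` for `x ≠ y`, where `P_{xy}` exchanges the two spins, and
`S_x · S_x = 3 / 4`. -/
lemma spin_dot_spin_apply (x y : Λ) (φ : SpinSpace Λ) (σ : Λ → Fin 2) :
    ∑ j, (spin x j * spin y j) φ σ =
      1 / 2 * φ (exchange x y σ) - 1 / 4 * φ σ + if x = y then 1 / 2 * φ σ else 0 := by
  by_cases hxy : x = y
  · subst hxy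
    rw [exchange_of_eq rfl, if_pos rfl]
    simp only [spin, siteOp_mul, siteOp_apply, Fin.sum_univ_three, Fin.sum_univ_two, pauli]
    have h := Function.update_eq_self x σ
    rcases Fin.exists_fin_two.1 ⟨σ x, rfl⟩ with h0 | h0 <;> rw [h0] at h ⊢ <;>
      simp [h, Matrix.mul_apply] <;> ring_nf <;> simp <;> ring
  · rw [if_neg hxy, exchange_eq_update]
    simp only [spin, mul_apply_eq_comp, siteOp_apply, Fin.sum_univ_three, Fin.sum_univ_two, pauli]
    have hx := Function.update_eq_self x σ
    have hy := Function.update_eq_self y σ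
    have hy' : ∀ s, Function.update (Function.update σ x s) y (σ y) = Function.update σ x s := by
      intro s
      rw [Function.update_comm hxy, hy]
    have hyx : y ≠ x := fun h => hxy h.symm
    rcases Fin.exists_fin_two.1 ⟨σ x, rfl⟩ with h0 | h0 <;>
    rcases Fin.exists_fin_two.1 ⟨σ y, rfl⟩ with h1 | h1 <;>
    rw [h0] at hx <;> rw [h1] at hy hy' <;>
      simp [h0, h1, hx, hy, hy', hyx] <;> ring_nf <;> simp <;> ring

lemma spinDot_apply (A B : Finset Λ) (φ : SpinSpace Λ) (σ : Λ → Fin 2) :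
    spinDot A B φ σ = ∑ x ∈ A, ∑ y ∈ B,
      (1 / 2 * φ (exchange x y σ) - 1 / 4 * φ σ + if x = y then 1 / 2 * φ σ else 0) := by
  have h : spinDot A B = ∑ x ∈ A, ∑ y ∈ B, ∑ j, spin x j * spin y j := by
    simp only [spinDot, spinOn, Finset.sum_mul_sum]
    rw [Finset.sum_comm]
    exact Finset.sum_congr rfl fun x _ => Finset.sum_comm
  simp only [← spin_dot_spin_apply, h, sum_apply, WithLp.ofLp_sum, Finset.sum_apply]

lemma spinDot_apply_of_disjoint {A B : Finset Λ} (h : Disjoint A B) (φ : SpinSpace Λ)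
    (σ : Λ → Fin 2) :
    spinDot A B φ σ = ∑ x ∈ A, ∑ y ∈ B, (1 / 2 * φ (exchange x y σ) - 1 / 4 * φ σ) := by
  rw [spinDot_apply]
  refine Finset.sum_congr rfl fun x hx => Finset.sum_congr rfl fun y hy => ?_
  rw [if_neg (Finset.disjoint_iff_ne.1 h x hx y hy), add_zero]

/-- Symmetry under exchanges within `A` means maximal spin `|A| / 2`: all `|A|²` pairs contribute
`1/4`, and the diagonal ones `1/2` more. -/
lemma spinDot_self_apply_of_forall {A : Finset Λ} {φ : SpinSpace Λ} {σ : Λ → Fin 2}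
    (h : ∀ x ∈ A, ∀ y ∈ A, φ (exchange x y σ) = φ σ) :
    spinDot A A φ σ = (A.card / 2 : ℂ) * (A.card / 2 + 1) * φ σ := by
  have h' : ∀ x ∈ A, ∑ y ∈ A,
      (1 / 2 * φ (exchange x y σ) - 1 / 4 * φ σ + if x = y then 1 / 2 * φ σ else 0) =
        (A.card : ℂ) * (1 / 4 * φ σ) + 1 / 2 * φ σ := by
    intro x hx
    rw [Finset.sum_add_distrib, Finset.sum_ite_eq A x, if_pos hx,
      Finset.sum_congr rfl fun y hy => by rw [h x hx y hy], Finset.sum_const, nsmul_eq_mul]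
    ring
  rw [spinDot_apply, Finset.sum_congr rfl h', Finset.sum_const, nsmul_eq_mul]
  ring

lemma spinDot_comm (A B : Finset Λ) : spinDot A B = spinDot B A := by
  ext φ σ
  rw [spinDot_apply, spinDot_apply, Finset.sum_comm]
  refine Finset.sum_congr rfl fun x _ => Finset.sum_congr rfl fun y _ => ?_
  have h1 : exchange x y σ = exchange y x σ := by
    funext z
    rw [exchange, exchange, Equiv.swap_comm]
  rw [h1]
  simp only [eq_comm]

lemma spinDot_union {A B : Finset Λ} (h : Disjoint A B) :
    spinDot (A ∪ B) (A ∪ B) = spinDot A A + spinDot B B + (2 : ℂ) • spinDot A B := by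
  have hsum : ∀ j, spinOn (A ∪ B) j = spinOn A j + spinOn B j := fun j =>
    Finset.sum_union h
  have hdot : spinDot (A ∪ B) (A ∪ B) = spinDot A A + spinDot A B + spinDot B A + spinDot B B := by
    simp only [spinDot, hsum, mul_add, add_mul, Finset.sum_add_distrib]
    abel
  rw [hdot, spinDot_comm B A, two_smul ℂ (spinDot A B)]
  abel

/-- The coefficients are real, and each exchange is an involution of the configurations. -/
lemma inner_spinDot_univ (φ ψ : SpinSpace Λ) :
    ⟪spinDot Finset.univ Finset.univ φ, ψ⟫_ℂ = ⟪φ, spinDot Finset.univ Finset.univ ψ⟫_ℂ := by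
  have hre : ∀ x y : Λ, ∑ σ, star (φ (exchange x y σ)) * ψ σ =
      ∑ σ, star (φ σ) * ψ (exchange x y σ) := by
    intro x y
    refine Finset.sum_equiv
      (⟨exchange x y, exchange x y, exchange_exchange x y, exchange_exchange x y⟩ :
        (Λ → Fin 2) ≃ (Λ → Fin 2)) (by simp) fun σ _ => ?_
    simp [exchange_exchange]
  have expand : ∀ x y : Λ,
      ∑ σ, star (1 / 2 * φ (exchange x y σ) - 1 / 4 * φ σ + if x = y then 1 / 2 * φ σ else 0) *
        ψ σ = ∑ σ, star (φ σ) *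
          (1 / 2 * ψ (exchange x y σ) - 1 / 4 * ψ σ + if x = y then 1 / 2 * ψ σ else 0) := by
    intro x y
    have e1 : ∀ σ, star (1 / 2 * φ (exchange x y σ) - 1 / 4 * φ σ +
        if x = y then 1 / 2 * φ σ else 0) * ψ σ =
        1 / 2 * (star (φ (exchange x y σ)) * ψ σ) +
          (-(1 / 4) + if x = y then 1 / 2 else 0) * (star (φ σ) * ψ σ) := by
      intro σ
      split_ifs <;> simp <;> ring
    have e2 : ∀ σ, star (φ σ) * (1 / 2 * ψ (exchange x y σ) - 1 / 4 * ψ σ +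
        if x = y then 1 / 2 * ψ σ else 0) =
        1 / 2 * (star (φ σ) * ψ (exchange x y σ)) +
          (-(1 / 4) + if x = y then 1 / 2 else 0) * (star (φ σ) * ψ σ) := by
      intro σ
      split_ifs <;> ring
    simp only [e1, e2, Finset.sum_add_distrib, ← Finset.mul_sum, hre]
  simp only [PiLp.inner_apply, RCLike.inner_apply', spinDot_apply, Finset.mul_sum, map_sum,
    Finset.sum_mul]
  rw [Finset.sum_comm, Finset.sum_comm (s := Finset.univ (α := Λ → Fin 2))]
  refine Finset.sum_congr rfl fun x _ => ?_
  rw [Finset.sum_comm, Finset.sum_comm (s := Finset.univ (α := Λ → Fin 2))]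
  exact Finset.sum_congr rfl fun y _ => expand x y

lemma inner_totalSpinSq (φ ψ : zeroSector Λ) :
    ⟪totalSpinSq Λ φ, ψ⟫_ℂ = ⟪φ, totalSpinSq Λ ψ⟫_ℂ :=
  inner_spinDot_univ (φ : SpinSpace Λ) ψ

lemma mem_zeroSector_iff {φ : SpinSpace Λ} :
    φ ∈ zeroSector Λ ↔ ∀ σ, 2 * countUp Finset.univ σ ≠ Fintype.card Λ → φ σ = 0 := by
  have h : ∀ σ, spinOn (Finset.univ : Finset Λ) 2 φ σ =
      (1 / 2 : ℂ) * (2 * countUp Finset.univ σ - Fintype.card Λ) * φ σ := by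
    intro σ
    have hx : ∀ x, spin x 2 φ σ = (![1 / 2, -1 / 2] : Fin 2 → ℂ) (σ x) * φ σ := by
      intro x
      have h := Function.update_eq_self x σ
      rcases Fin.exists_fin_two.1 ⟨σ x, rfl⟩ with h0 | h0 <;> rw [h0] at h ⊢
      · simp [spin, pauli, Fin.sum_univ_two, h, h0]
      · simp [spin, pauli, Fin.sum_univ_two, h, h0]
        ring
    simp only [spinOn, sum_apply, WithLp.ofLp_sum, Finset.sum_apply, hx]
    rw [← Finset.sum_mul, sum_apply_eq_countUp]
    simp only [Matrix.cons_val_zero, Matrix.cons_val_one, Finset.card_univ]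
    ring
  constructor
  · intro hφ σ hσ
    have h0 : spinOn (Finset.univ : Finset Λ) 2 φ σ = 0 := by
      rw [show spinOn (Finset.univ : Finset Λ) 2 φ = 0 from hφ]
      rfl
    rw [h] at h0
    have hne : (2 : ℂ) * countUp Finset.univ σ - Fintype.card Λ ≠ 0 :=
      sub_ne_zero.2 (by exact_mod_cast hσ)
    exact (mul_eq_zero.1 h0).resolve_left (mul_ne_zero (by norm_num) hne)
  · intro hφ
    change spinOn (Finset.univ : Finset Λ) 2 φ = 0
    ext σ
    rw [h]
    by_cases hσ : 2 * countUp Finset.univ σ = Fintype.card Λ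
    · have : (2 : ℂ) * countUp Finset.univ σ - Fintype.card Λ = 0 := by
        rw [sub_eq_zero]; exact_mod_cast hσ
      rw [this]; simp
    · rw [hφ σ hσ]; simp

end Spin


/-! ### The ground state of the Marshall–Lieb–Mattis Hamiltonian -/

section GroundState

variable {Λ : Type u} [Fintype Λ]

/-- The amplitude of a spin configuration in the ground state of the Marshall–Lieb–Mattis
Hamiltonian, `A` being the larger one of the two sublattices. -/
noncomputable def mlmAmplitude (A : Finset Λ) (σ : Λ → Fin 2) : ℝ :=
  if 2 * countUp Finset.univ σ = Fintype.card Λ then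
    (-1) ^ countUp A σ * ((countUp A σ).factorial * (A.card - countUp A σ).factorial : ℕ) else 0

lemma mlmAmplitude_ne_zero {A : Finset Λ} {σ : Λ → Fin 2}
    (h : 2 * countUp Finset.univ σ = Fintype.card Λ) : mlmAmplitude A σ ≠ 0 := by
  rw [mlmAmplitude, if_pos h]
  refine mul_ne_zero (pow_ne_zero _ (by norm_num)) ?_
  exact_mod_cast mul_ne_zero (Nat.factorial_ne_zero _) (Nat.factorial_ne_zero _)

variable [DecidableEq Λ]

lemma countUp_univ_exchange (x y : Λ) (σ : Λ → Fin 2) :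
    countUp Finset.univ (exchange x y σ) = countUp Finset.univ σ :=
  countUp_exchange_of_mem_iff (by simp) σ

lemma mlmAmplitude_exchange_of_mem_iff {A : Finset Λ} {x y : Λ} (h : x ∈ A ↔ y ∈ A)
    (σ : Λ → Fin 2) : mlmAmplitude A (exchange x y σ) = mlmAmplitude A σ := by
  simp only [mlmAmplitude, countUp_univ_exchange, countUp_exchange_of_mem_iff h]

/-- Marshall's sign rule. -/
lemma mlmAmplitude_mul_exchange_nonpos {A : Finset Λ} {x y : Λ} (hx : x ∈ A) (hy : y ∉ A)
    {σ : Λ → Fin 2} (hσ : σ x ≠ σ y) :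
    mlmAmplitude A σ * mlmAmplitude A (exchange x y σ) ≤ 0 := by
  have hk := countUp_exchange_add hx hy σ
  simp only [mlmAmplitude, countUp_univ_exchange]
  split_ifs with h
  swap
  · simp
  have hsign : ((-1 : ℝ) ^ countUp A σ) * (-1) ^ countUp A (exchange x y σ) = -1 := by
    rw [← pow_add]
    refine Odd.neg_one_pow ?_
    rcases Fin.exists_fin_two.1 ⟨σ x, rfl⟩ with h0 | h0 <;>
    rcases Fin.exists_fin_two.1 ⟨σ y, rfl⟩ with h1 | h1 <;>
    simp [h0, h1] at hk hσ <;> rw [Nat.odd_iff] <;> omega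
  rw [mul_mul_mul_comm, hsign, neg_one_mul, neg_nonpos]
  positivity

/-- The eigenvalue equation `S_A · S_B ψ = -(|B| / 2) (|A| / 2 + 1) ψ` in coordinates. -/
lemma mlmAmplitude_eigenvalue_equation {A B : Finset Λ} (hdisj : Disjoint A B)
    (hunion : A ∪ B = Finset.univ) (hle : B.card ≤ A.card) (σ : Λ → Fin 2) :
    ∑ x ∈ A, ∑ y ∈ B, (1 / 2 * mlmAmplitude A (exchange x y σ) - 1 / 4 * mlmAmplitude A σ) =
      -((B.card / 2 : ℝ) * (A.card / 2 + 1)) * mlmAmplitude A σ := by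
  by_cases hσ : 2 * countUp Finset.univ σ = Fintype.card Λ
  swap
  · have h0 : ∀ x y, mlmAmplitude A (exchange x y σ) = 0 := fun x y => by
      rw [mlmAmplitude, countUp_univ_exchange, if_neg hσ]
    simp [h0, show mlmAmplitude A σ = 0 from if_neg hσ]
  let c : ℕ → ℝ := fun k => (-1) ^ k * (k.factorial * (A.card - k).factorial : ℕ)
  have hamp : ∀ τ, 2 * countUp Finset.univ τ = Fintype.card Λ →
      mlmAmplitude A τ = c (countUp A τ) := fun τ hτ => if_pos hτ
  -- This recursion is what the factorials and the alternating sign are chosen for.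
  have hc : ∀ k, k < A.card → (A.card - k : ℝ) * c (k + 1) = -(k + 1) * c k := by
    intro k hk
    obtain ⟨d, hd⟩ := Nat.exists_eq_add_of_lt hk
    have h1 : A.card - k = d + 1 := by omega
    have h2 : A.card - (k + 1) = d := by omega
    simp only [c, h1, h2, Nat.factorial_succ, pow_succ]
    rw [hd]
    push_cast
    ring
  have hsplit : countUp A σ + countUp B σ = countUp Finset.univ σ := by
    rw [← hunion, countUp_union hdisj]
  have hcard : A.card + B.card = Fintype.card Λ := by
    rw [← Finset.card_union_of_disjoint hdisj, hunion, Finset.card_univ]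
  have hkA := countUp_le A σ
  have hlB := countUp_le B σ
  set k := countUp A σ
  set l := countUp B σ
  rw [hamp σ hσ]
  -- The summand depends only on the spins at `x` (row) and `y` (column), `0` being up. The
  -- truncated `k - 1` is harmless, since that entry occurs `k (|B| - l)` times.
  let F : Fin 2 → Fin 2 → ℝ := ![![1 / 4 * c k, 1 / 2 * c (k - 1) - 1 / 4 * c k],
    ![1 / 2 * c (k + 1) - 1 / 4 * c k, 1 / 4 * c k]]
  have hF : ∀ x ∈ A, ∀ y ∈ B,
      1 / 2 * mlmAmplitude A (exchange x y σ) - 1 / 4 * c k = F (σ x) (σ y) := by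
    intro x hx y hy
    have hyA : y ∉ A := fun h => Finset.disjoint_left.1 hdisj h hy
    have hk := countUp_exchange_add hx hyA σ
    rw [hamp _ (by rw [countUp_univ_exchange]; exact hσ)]
    rcases Fin.exists_fin_two.1 ⟨σ x, rfl⟩ with h0 | h0 <;>
    rcases Fin.exists_fin_two.1 ⟨σ y, rfl⟩ with h1 | h1 <;>
    simp only [h0, h1, if_true, Fin.isValue, one_ne_zero, if_false, add_zero] at hk
    · have e : countUp A (exchange x y σ) = k := by omega
      simp only [e, h0, h1, F]
      simp
      ring
    · have e : countUp A (exchange x y σ) = k - 1 := by omega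
      simp [e, h0, h1, F]
    · have e : countUp A (exchange x y σ) = k + 1 := by omega
      simp [e, h0, h1, F]
    · have e : countUp A (exchange x y σ) = k := by omega
      simp only [e, h0, h1, F]
      simp
      ring
  rw [Finset.sum_congr rfl fun x hx => Finset.sum_congr rfl fun y hy => hF x hx y hy]
  simp only [fun x => sum_apply_eq_countUp B σ (F (σ x))]
  rw [sum_apply_eq_countUp A σ (fun s => (countUp B σ : ℝ) * F s 0 +
    (B.card - countUp B σ) * F s 1)]
  have hdown : ((B.card : ℝ) - l) * (k * c (k - 1)) =
      -(((B.card : ℝ) - l) * ((A.card - k + 1) * c k)) := by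
    rcases Nat.eq_zero_or_pos k with h0 | hpos
    -- The recursion has no predecessor here; `l = |Λ| / 2 ≥ |B|` makes the prefactor vanish. This
    -- uses `|B| ≤ |A|`.
    · have : l = B.card := by omega
      simp [this]
    · obtain ⟨j, hj⟩ := Nat.exists_eq_add_of_lt hpos
      have hj' : k = j + 1 := by omega
      have := hc j (by omega)
      rw [hj', Nat.add_sub_cancel]
      push_cast
      linear_combination ((B.card : ℝ) - l) * this
  have hup : (l : ℝ) * ((A.card - k) * c (k + 1)) = -(l * ((k + 1) * c k)) := by
    rcases hkA.eq_or_lt with h0 | hlt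
    -- If `k = |A|`, balance gives `l = (|B| - |A|) / 2 ≤ 0`, again by `|B| ≤ |A|`.
    · have : l = 0 := by omega
      simp [this]
    · rw [hc k hlt]
      ring
  change (k : ℝ) * (l * (1 / 4 * c k) + (B.card - l) * (1 / 2 * c (k - 1) - 1 / 4 * c k)) +
    (A.card - k) * (l * (1 / 2 * c (k + 1) - 1 / 4 * c k) + (B.card - l) * (1 / 4 * c k)) = _
  linear_combination (1 / 2 : ℝ) * hdown + (1 / 2 : ℝ) * hup

/-- The unnormalized ground state of the Marshall–Lieb–Mattis Hamiltonian. -/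
noncomputable def mlmGroundState (A : Finset Λ) : SpinSpace Λ :=
  WithLp.toLp 2 fun σ => (mlmAmplitude A σ : ℂ)

lemma mlmGroundState_mem_zeroSector (A : Finset Λ) : mlmGroundState A ∈ zeroSector Λ := by
  rw [mem_zeroSector_iff]
  intro σ hσ
  simp [mlmGroundState, mlmAmplitude, hσ]

lemma exists_balanced (heven : Even (Fintype.card Λ)) :
    ∃ σ : Λ → Fin 2, 2 * countUp Finset.univ σ = Fintype.card Λ := by
  obtain ⟨n, hn⟩ := heven
  obtain ⟨S, -, hS⟩ := Finset.exists_subset_card_eq (s := (Finset.univ : Finset Λ)) (n := n)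
    (by rw [Finset.card_univ]; omega)
  refine ⟨fun x => if x ∈ S then 0 else 1, ?_⟩
  have : (Finset.univ.filter fun x => (if x ∈ S then (0 : Fin 2) else 1) = 0) = S := by
    ext x
    simp
  rw [countUp, this, hS, hn]
  ring

lemma mlmGroundState_ne_zero (heven : Even (Fintype.card Λ)) (A : Finset Λ) :
    mlmGroundState A ≠ 0 := by
  obtain ⟨σ, hσ⟩ := exists_balanced heven
  intro h
  have h0 : mlmGroundState A σ = 0 := by rw [h]; rfl
  exact mlmAmplitude_ne_zero (A := A) hσ (Complex.ofReal_eq_zero.1 h0)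

lemma spinDot_mlmGroundState {A B : Finset Λ} (hdisj : Disjoint A B)
    (hunion : A ∪ B = Finset.univ) (hle : B.card ≤ A.card) :
    spinDot A B (mlmGroundState A) =
      ((-((B.card / 2 : ℝ) * (A.card / 2 + 1)) : ℝ) : ℂ) • mlmGroundState A := by
  ext σ
  rw [spinDot_apply_of_disjoint hdisj]
  have h := congrArg (fun r : ℝ => (r : ℂ))
    (mlmAmplitude_eigenvalue_equation hdisj hunion hle σ)
  simp only [PiLp.smul_apply, smul_eq_mul, mlmGroundState]
  rw [← Complex.ofReal_mul, ← h]
  push_cast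
  rfl

/-- Expand `S_tot² = S_A² + S_B² + 2 S_A · S_B`: both sublattice spins are maximal and the cross
term is the eigenvalue equation. -/
lemma spinDot_univ_mlmGroundState {A B : Finset Λ} (hdisj : Disjoint A B)
    (hunion : A ∪ B = Finset.univ) (hle : B.card ≤ A.card) :
    spinDot Finset.univ Finset.univ (mlmGroundState A) =
      ((sStar A B * (sStar A B + 1) : ℝ) : ℂ) • mlmGroundState A := by
  have hA : spinDot A A (mlmGroundState A) =
      ((A.card / 2 : ℂ) * (A.card / 2 + 1)) • mlmGroundState A := by
    ext σ
    refine spinDot_self_apply_of_forall fun x hx y hy => ?_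
    simp only [mlmGroundState]
    rw [mlmAmplitude_exchange_of_mem_iff (by simp [hx, hy])]
  have hB : spinDot B B (mlmGroundState A) =
      ((B.card / 2 : ℂ) * (B.card / 2 + 1)) • mlmGroundState A := by
    ext σ
    refine spinDot_self_apply_of_forall fun x hx y hy => ?_
    simp only [mlmGroundState]
    rw [mlmAmplitude_exchange_of_mem_iff
      (by simp [Finset.disjoint_right.1 hdisj hx, Finset.disjoint_right.1 hdisj hy])]
  have hS : sStar A B = (A.card - B.card) / 2 := by
    rw [sStar, abs_of_nonneg]
    exact sub_nonneg.2 (by exact_mod_cast hle)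
  rw [← hunion, spinDot_union hdisj, add_apply, add_apply, smul_apply, hA, hB,
    spinDot_mlmGroundState hdisj hunion hle, smul_smul, ← add_smul, ← add_smul, hS]
  congr 1
  push_cast
  ring

/-- The energy of `mlmGroundState` is the lowest eigenvalue on `𝔥_0`. -/
lemma le_eigenvalue_of_mem_zeroSector {A B : Finset Λ} (hdisj : Disjoint A B)
    (hunion : A ∪ B = Finset.univ) (hle : B.card ≤ A.card) {φ : SpinSpace Λ}
    (hφ : φ ∈ zeroSector Λ) (hφ0 : φ ≠ 0) {r : ℝ} (hr : spinDot A B φ = (r : ℂ) • φ) :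
    -((B.card / 2 : ℝ) * (A.card / 2 + 1)) ≤ r := by
  set w := mlmAmplitude A
  rw [mem_zeroSector_iff] at hφ
  -- Maximum principle: the eigenvalue equation for `φ` is compared with that for `w` where `|φ| /
  -- |w|` is largest. Outside the sector `w = 0`, and the quotient is `0` by convention.
  obtain ⟨σ, -, hmax⟩ := Finset.exists_max_image (Finset.univ : Finset (Λ → Fin 2))
    (fun τ => ‖φ τ‖ / |w τ|) Finset.univ_nonempty
  set q := ‖φ σ‖ / |w σ|
  have hbound : ∀ τ, ‖φ τ‖ ≤ q * |w τ| := by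
    intro τ
    by_cases hτ : 2 * countUp Finset.univ τ = Fintype.card Λ
    · exact (div_le_iff₀ (abs_pos.2 (mlmAmplitude_ne_zero hτ))).1 (hmax τ (Finset.mem_univ τ))
    · rw [hφ τ hτ, norm_zero]
      positivity
  have hq : 0 < q := by
    by_contra hq
    have hq0 : q = 0 := le_antisymm (not_lt.1 hq) (by positivity)
    refine hφ0 ?_
    ext τ
    have := hbound τ
    rw [hq0, zero_mul] at this
    exact norm_le_zero_iff.1 this
  have hw : w σ ≠ 0 := by
    intro h
    simp [q, h] at hq
  have hσ : ‖φ σ‖ = q * |w σ| := (div_mul_cancel₀ _ (abs_ne_zero.2 hw)).symm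
  have hσ2 : ‖φ σ‖ ^ 2 = q ^ 2 * (w σ * w σ) := by
    rw [hσ, mul_pow, sq_abs]; ring
  -- For unequal spins the sign rule makes the `w` term equal to minus its modulus, the least value
  -- the bound on `φ` permits; for equal spins there is equality.
  have hterm : ∀ x ∈ A, ∀ y ∈ B,
      q ^ 2 * (w σ * (1 / 2 * w (exchange x y σ) - 1 / 4 * w σ)) ≤
        (star (φ σ) * (1 / 2 * φ (exchange x y σ) - 1 / 4 * φ σ)).re := by
    intro x hx y hy
    have hself : (star (φ σ) * φ σ).re = ‖φ σ‖ ^ 2 := by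
      rw [Complex.star_def, Complex.conj_mul']
      norm_cast
    have hexp : (star (φ σ) * (1 / 2 * φ (exchange x y σ) - 1 / 4 * φ σ)).re =
        1 / 2 * (star (φ σ) * φ (exchange x y σ)).re - 1 / 4 * ‖φ σ‖ ^ 2 := by
      rw [← hself]
      simp
      ring
    rw [hexp]
    by_cases hxy : σ x = σ y
    · rw [exchange_of_eq hxy, hself, hσ2]
      apply le_of_eq
      ring
    · have hyA : y ∉ A := fun h => Finset.disjoint_left.1 hdisj h hy
      have hneg := mlmAmplitude_mul_exchange_nonpos hx hyA hxy
      have hre : -(q ^ 2 * (|w σ| * |w (exchange x y σ)|)) ≤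
          (star (φ σ) * φ (exchange x y σ)).re := by
        have h1 := (abs_le.1 (Complex.abs_re_le_norm (star (φ σ) * φ (exchange x y σ)))).1
        refine le_trans (neg_le_neg ?_) h1
        rw [norm_mul, norm_star]
        calc ‖φ σ‖ * ‖φ (exchange x y σ)‖ ≤ (q * |w σ|) * (q * |w (exchange x y σ)|) :=
              mul_le_mul (hbound _) (hbound _) (norm_nonneg _) (by positivity)
          _ = _ := by ring
      rw [← abs_mul, abs_of_nonpos hneg] at hre
      rw [hσ2]
      linarith
  have hsum := Finset.sum_le_sum fun x hx => Finset.sum_le_sum fun y hy => hterm x hx y hy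
  simp only [← Finset.mul_sum, ← Complex.re_sum] at hsum
  rw [mlmAmplitude_eigenvalue_equation hdisj hunion hle, ← spinDot_apply_of_disjoint hdisj, hr,
    PiLp.smul_apply, smul_eq_mul, mul_left_comm (star (φ σ)), Complex.re_ofReal_mul, Complex.star_def,
    Complex.conj_mul'] at hsum
  norm_cast at hsum
  rw [hσ2] at hsum
  have hpos : 0 < q ^ 2 * (w σ * w σ) := mul_pos (by positivity) (mul_self_pos.2 hw)
  refine le_of_mul_le_mul_right ?_ hpos
  linarith

end GroundState

/-! ### The quantum number of the Marshall–Lieb–Mattis Hamiltonian -/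

section Main

variable {Λ : Type u}

lemma sStar_comm (A B : Finset Λ) : sStar A B = sStar B A := by
  rw [sStar, sStar, abs_sub_comm]

variable [Fintype Λ] [DecidableEq Λ]

lemma nontrivial_zeroSector (heven : Even (Fintype.card Λ)) : Nontrivial (zeroSector Λ) :=
  ⟨⟨mlmGroundState ∅, mlmGroundState_mem_zeroSector ∅⟩, 0, fun h =>
    mlmGroundState_ne_zero heven ∅ (congrArg Subtype.val h)⟩

lemma mlmHamiltonian_comm (A B : Finset Λ) : mlmHamiltonian A B = mlmHamiltonian B A := by
  have : spinDotZero A B = spinDotZero B A := by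
    ext1 φ
    apply Subtype.ext
    change spinDot A B φ = spinDot B A φ
    rw [spinDot_comm]
  rw [mlmHamiltonian, mlmHamiltonian, this]

/-- The ground state of the Marshall–Lieb–Mattis Hamiltonian has total spin `S⋆`. -/
lemma mlmHamiltonian_hasGroundStateQuantumNumber {A B : Finset Λ} (hdisj : Disjoint A B)
    (hunion : A ∪ B = Finset.univ) (heven : Even (Fintype.card Λ))
    (hadm : mlmHamiltonian A B ∈ admissible (totalSpinSq Λ)) :
    HasGroundStateQuantumNumber (totalSpinSq Λ) (mlmHamiltonian A B)
      (sStar A B * (sStar A B + 1)) := by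
  -- The explicit vector requires `A` to be the larger sublattice; the Hamiltonian and `S⋆` are
  -- symmetric in `A` and `B`.
  wlog hle : B.card ≤ A.card generalizing A B
  · rw [mlmHamiltonian_comm, sStar_comm]
    exact this hdisj.symm (by rw [Finset.union_comm, hunion])
      (by rwa [mlmHamiltonian_comm]) (le_of_not_ge hle)
  have := nontrivial_zeroSector heven
  refine hasGroundStateQuantumNumber_ofCLM hadm
    (ψ := ⟨mlmGroundState A, mlmGroundState_mem_zeroSector A⟩)
    (fun h => mlmGroundState_ne_zero heven A (congrArg Subtype.val h))
    (Subtype.ext (spinDot_mlmGroundState hdisj hunion hle))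
    (Subtype.ext (spinDot_univ_mlmGroundState hdisj hunion hle)) fun r φ hφ0 hφ => ?_
  exact le_eigenvalue_of_mem_zeroSector hdisj hunion hle φ.2
    (fun h => hφ0 (Subtype.ext h)) (congrArg Subtype.val hφ)

end Main

end SpinStability

open SpinStability in
theorem theorem5p1 {Λ : Type u} [Fintype Λ] [DecidableEq Λ] (A B : Finset Λ)
    (hdisj : Disjoint A B) (hunion : A ∪ B = Finset.univ) (heven : Even (Fintype.card Λ))
    (H : Hamiltonian (zeroSector Λ))
    (hH : H ∈ stabilityClass (totalSpinSq Λ) (mlmHamiltonian A B)) :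
    HasGroundStateQuantumNumber (totalSpinSq Λ) H (sStar A B * (sStar A B + 1)) := by
  have := nontrivial_zeroSector heven
  refine Connected.hasGroundStateQuantumNumber (X := zeroSector Λ) (fun φ ψ => ?_) hH.2
    (mlmHamiltonian_hasGroundStateQuantumNumber hdisj hunion heven hH.2.left_mem_admissible)
  exact inner_totalSpinSq φ ψ
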